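/- Fix $\lambda,\delta\in\mathbb R$ with $\lambda>0$. Let $H^2_{imm}$ be the set of all $\gamma\in H^2([0,2\pi];\mathbb R^2)$ with $\partial_x\gamma\neq0$ on $[0,2\pi]$, $\gamma(0)=\gamma(2\pi)$, $\partial_x\gamma(0)=\partial_x\gamma(2\pi)$, and let $H^1_{per}$ be the set of all $\eta\in H^1([0,2\pi];\mathbb R^2)$ with $\eta(0)=\eta(2\pi)$. For $\gamma\in H^2_{imm}$ write $\partial_s=|\partial_x\gamma|^{-1}\partial_x$, $\mathrm ds=|\partial_x\gamma|\,\mathrm dx$, $\tau=\partial_s\gamma$, $\nu=J\tau$ with $J$ the counterclockwise rotation by $\pi/2$, $\kappa=\langle\partial_s\tau,\nu\rangle$, $L(\gamma)=\int_\gamma 1\,\mathrm ds$, and $A(\gamma)=-\tfrac12\int_0^{2\pi}\langle\gamma,J\partial_x\gamma\rangle\,\mathrm dx$ for the signed area; for $\eta\in H^1_{per}$ write $\operatorname{div}_\gamma\eta=\langle\partial_s\eta,\tau\rangle$ and $\nabla_\gamma\eta=\partial_s\eta\otimes\tau$. Put $$E_{LM}(\gamma,\eta)=\frac12\int_\gamma(\kappa+\delta\operatorname{div}_\gamma\eta)^2\,\mathrm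 ds+\frac\lambda2\int_\gamma|\nabla_\gamma\eta|^2\,\mathrm ds+L(\gamma).$$ Let $m=2\pi\sqrt{2\lambda/(\lambda+\delta^2)}$ and $R=\sqrt\lambda/\sqrt{2(\lambda+\delta^2)}$. We say that $\gamma$ traces a circle of radius $R$ once if $\gamma$ is injective on $[0,2\pi)$ and $\gamma([0,2\pi])$ is a circle of radius $R$ (with arbitrary centre), and that $\gamma$ has constant speed if $|\partial_x\gamma|=L(\gamma)/(2\pi)$ on $[0,2\pi]$. Then the following hold. 1. $E_{LM}(\gamma,\eta)\ge m$ for all $(\gamma,\eta)\in H^2_{imm}\times H^1_{per}$, and equality is attained by some such pair with $\gamma$ of constant speed and $\int_0^{2\pi}\gamma\,\mathrm dx=\int_0^{2\pi}\eta\,\mathrm dx=0$. 2. For all $(\gamma,\eta)\in H^2_{imm}\times H^1_{per}$, $E_{LM}(\gamma,\eta)=m$ if and only if $\gamma$ traces a circle of radius $R$ once and there is a constant $c\in\mathbb R^2$ with $\eta=\frac{\delta}{\lambda+\delta^2}\nu+c$ on $[0,2\pi]$. 3. If moreover $\gamma$ has constant speed and $\int_0^{2\pi}\eta\,\mathrm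 dx=0$, then $E_{LM}(\gamma,\eta)=m$ if and only if $\gamma$ traces a circle of radius $R$ once and $\eta=\frac{\delta}{\lambda+\delta^2}\nu$ on $[0,2\pi]$. 4. Call $(\gamma,\eta)$ a normalized minimizer if it minimizes $E_{LM}$ among all pairs in $H^2_{imm}\times H^1_{per}$ with $\int_0^{2\pi}\gamma\,\mathrm dx=\int_0^{2\pi}\eta\,\mathrm dx=0$ and $\gamma$ has constant speed. Every normalized minimizer has $A(\gamma)\ne0$, and normalized minimizers with $A(\gamma)>0$ and with $A(\gamma)<0$ both exist. For each fixed orientation (sign of $A(\gamma)$) the normalized minimizer is unique up to rotation: if $(\gamma_1,\eta_1)$ and $(\gamma_2,\eta_2)$ are normalized minimizers with $A(\gamma_1)A(\gamma_2)>0$, then there is a rotation $Q$ about the origin with $\gamma_2=Q\gamma_1$ and $\eta_2=Q\eta_1$ on $[0,2\pi]$. If $A(\gamma_1)A(\gamma_2)<0$, then there is a rotation $Q$ about the origin with $\gamma_2(x)=Q\gamma_1(2\pi-x)$ and $\eta_2(x)=-Q\eta_1(2\pi-x)$ for all $x\in[0,2\pi]$. -/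

import Mathlib

open Set MeasureTheory
open scoped ContDiff

noncomputable section

namespace Surfactant

/-- The Euclidean plane. -/
abbrev Plane : Type := EuclideanSpace ℝ (Fin 2)

/-- The parameter interval `[0, 2π]`. Curves and vector fields are given as functions on `ℝ`, but
only their values on this interval matter. -/
def I : Set ℝ := Icc 0 (2 * Real.pi)

/-- `g` is a weak derivative of `u` on `(0, 2π)`, tested against `C_c^∞((0, 2π))`. -/
def HasWeakDeriv (u g : ℝ → Plane) : Prop :=
  ∀ φ : ℝ → ℝ, ContDiff ℝ ∞ φ → HasCompactSupport φ → tsupport φ ⊆ Ioo 0 (2 * Real.pi) →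
    ∫ x in (0 : ℝ)..(2 * Real.pi), deriv φ x • u x =
      - ∫ x in (0 : ℝ)..(2 * Real.pi), φ x • g x

/-- `g ∈ L²((0, 2π); ℝ²)`. -/
def InL2 (g : ℝ → Plane) : Prop :=
  MemLp g 2 (volume.restrict (Ioo 0 (2 * Real.pi)))

/-- `u ∈ H¹([0, 2π]; ℝ²)`, with `u` the continuous representative (so that point values make
sense): the weak derivative exists and lies in `L²`. -/
def IsH1 (u : ℝ → Plane) : Prop :=
  ContinuousOn u I ∧ ∃ g, InL2 g ∧ HasWeakDeriv u g

/-- `u ∈ H²([0, 2π]; ℝ²)`, with `u` the continuous representative: the weak derivatives of first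
and second order exist and lie in `L²`. -/
def IsH2 (u : ℝ → Plane) : Prop :=
  ContinuousOn u I ∧ ∃ g h, InL2 g ∧ InL2 h ∧ HasWeakDeriv u g ∧ HasWeakDeriv g h

/-- The classical derivative `∂ₓ u` on `[0, 2π]`, one-sided at the two end points. For `u ∈ H¹`
it exists almost everywhere and is almost everywhere equal to the weak derivative; for `u ∈ H²` it
exists everywhere and is continuous. -/
def D (u : ℝ → Plane) (x : ℝ) : Plane := derivWithin u I x

/-- The set `H²_imm` of closed immersed plane curves. -/
def IsImmersion (γ : ℝ → Plane) : Prop :=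
  IsH2 γ ∧ (∀ x ∈ I, D γ x ≠ 0) ∧ γ 0 = γ (2 * Real.pi) ∧ D γ 0 = D γ (2 * Real.pi)

/-- The space `H¹_per` of periodic vector fields. -/
def IsH1Per (η : ℝ → Plane) : Prop :=
  IsH1 η ∧ η 0 = η (2 * Real.pi)

/-- The counterclockwise rotation of the plane by the angle `θ`. -/
def rot (θ : ℝ) (v : Plane) : Plane :=
  !₂[Real.cos θ * v 0 - Real.sin θ * v 1, Real.sin θ * v 0 + Real.cos θ * v 1]

/-- The counterclockwise rotation of the plane by `π/2`. -/
def J (v : Plane) : Plane := !₂[- v 1, v 0]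

/-- The arc length derivative `∂ₛ u = |∂ₓ γ|⁻¹ ∂ₓ u` along `γ`. -/
def arcDeriv (γ u : ℝ → Plane) (x : ℝ) : Plane := ‖D γ x‖⁻¹ • D u x

/-- The unit tangent `τ = ∂ₛ γ`. -/
def tangent (γ : ℝ → Plane) (x : ℝ) : Plane := arcDeriv γ γ x

/-- The unit normal `ν = J τ`. -/
def normal (γ : ℝ → Plane) (x : ℝ) : Plane := J (tangent γ x)

/-- The oriented curvature `κ`, given by `∂ₛ τ = κ ν`. -/
def curvature (γ : ℝ → Plane) (x : ℝ) : ℝ :=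
  inner ℝ (arcDeriv γ (tangent γ) x) (normal γ x)

/-- The divergence of `η` along `γ`. -/
def divergence (γ η : ℝ → Plane) (x : ℝ) : ℝ :=
  inner ℝ (arcDeriv γ η x) (tangent γ x)

/-- The gradient matrix `∇_γ η = ∂ₛ η ⊗ τ`. -/
def gradient (γ η : ℝ → Plane) (x : ℝ) : Matrix (Fin 2) (Fin 2) ℝ :=
  Matrix.of fun i j => arcDeriv γ η x i * tangent γ x j

/-- The integral `∫_γ f ds` with respect to arc length. -/
def lineIntegral (γ : ℝ → Plane) (f : ℝ → ℝ) : ℝ :=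
  ∫ x in (0 : ℝ)..(2 * Real.pi), f x * ‖D γ x‖

/-- The length `L(γ)`. -/
def length (γ : ℝ → Plane) : ℝ := lineIntegral γ fun _ => 1

/-- The signed area `A(γ) = -(1/2) ∫ ⟨γ, J ∂ₓ γ⟩ dx`; it is positive for a circle traversed
counterclockwise. -/
def signedArea (γ : ℝ → Plane) : ℝ :=
  -(1 / 2) * ∫ x in (0 : ℝ)..(2 * Real.pi), inner ℝ (γ x) (J (D γ x))

/-- The energy `E_LM`; the squared norm of the gradient matrix is the sum of the squares of its
entries. -/
def energy (lam δ : ℝ) (γ η : ℝ → Plane) : ℝ :=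
  1 / 2 * lineIntegral γ (fun x => (curvature γ x + δ * divergence γ η x) ^ 2)
    + lam / 2 * lineIntegral γ (fun x => ∑ i, ∑ j, gradient γ η x i j ^ 2)
    + length γ

/-- The lower bound `2π √(2λ/(λ+δ²))`. -/
def lowerBound (lam δ : ℝ) : ℝ := 2 * Real.pi * √(2 * lam / (lam + δ ^ 2))

/-- `γ` is parametrized proportionally to arc length. -/
def ConstSpeed (γ : ℝ → Plane) : Prop :=
  ∀ x ∈ I, ‖D γ x‖ = length γ / (2 * Real.pi)

/-- `u` has mean value zero. -/
def MeanZero (u : ℝ → Plane) : Prop :=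
  ∫ x in (0 : ℝ)..(2 * Real.pi), u x = 0

/-- `γ` traces a circle of radius `R` once: it is a simple closed curve whose trace is such a
circle. -/
def TracesCircleOnce (γ : ℝ → Plane) (R : ℝ) : Prop :=
  InjOn γ (Ico 0 (2 * Real.pi)) ∧ ∃ p : Plane, γ '' I = Metric.sphere p R

/-- The admissible pairs of the minimization problem: all pairs in `H²_imm × H¹_per` with both mean
values equal to zero. -/
def admissible : Set ((ℝ → Plane) × (ℝ → Plane)) :=
  {p | IsImmersion p.1 ∧ IsH1Per p.2 ∧ MeanZero p.1 ∧ MeanZero p.2}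

/-- `(γ, η)` minimizes the energy among all admissible pairs, and `γ` is parametrized
proportionally to arc length. -/
def IsNormalizedMinimizer (lam δ : ℝ) (γ η : ℝ → Plane) : Prop :=
  (γ, η) ∈ admissible ∧ IsMinOn (fun p => energy lam δ p.1 p.2) admissible (γ, η) ∧ ConstSpeed γ

/-- The same curve (or field) run through backwards. -/
def reverse (u : ℝ → Plane) (x : ℝ) : Plane := u (2 * Real.pi - x)

end Surfactant

end

/-! Write k = δ/(λ+δ²), d = ⟨∂ₛη, τ⟩ and e = ⟨∂ₛη, ν⟩. Since |∇η|² = d² + e², completing the square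
in d turns the energy into (λ+δ²)/2 ∫(d + kκ)² + λ/2 ∫e² + R²∫κ² + L, with R² = λ/(2(λ+δ²))
(`IsImmersion.energy_eq`). What remains is an elastic energy with length penalty, and the claim m =
4πR follows from ∫κ² ≥ 4π²/L and the arithmetic-geometric mean inequality.

The bound on ∫κ² is obtained from Wirtinger's inequality instead of a theorem on total curvature.
With q = 2π/L, N = ⟨γ-p, ν⟩ and p the arc length mean of γ, integration by parts gives ∫κN ds = -L,
hence ∫κ² = ∫(κ + q²N)² + 2q²L - q⁴∫N² (`IsImmersion.lineIntegral_curvature_sq`). Wirtinger in arc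
length says q²∫|γ-p|² ≤ L (`wirtinger_arcLength`), and N² ≤ |γ-p|². So E - 4πR is a sum of five
nonnegative terms (`IsImmersion.lowerBound_le_energy`).

If E = 4πR, all five vanish. Then L = 2πR and equality in Wirtinger leaves only the first Fourier
modes, so that γ is a trigonometric curve of constant speed in arc length, which is a circle run
through once (`IsImmersion.exists_isCircleParam_of_trig`). Moreover ∂ₛη = -kκτ = k∂ₛν, and an
absolutely continuous field with zero derivative is constant, so η = kν + c. Conversely, an
immersion tracing the circle once has the standard arc length parametrization
(`IsImmersion.exists_isCircleParam`), for which the energy can be computed. The normalizations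
remove the centre and c and make the polar angle affine with slope ±1; only a rotation and the
orientation remain (`IsNormalizedMinimizer.exists_unitVec`).

Because H¹ and H² are given by weak derivatives, these computations rest on the du Bois-Reymond
lemma, which makes such functions primitives of L² functions. -/

noncomputable section

namespace Surfactant

/-! ### Weak derivatives and the du Bois-Reymond lemma -/

/-- The primitive of a test function of integral zero is a test function. -/
lemma exists_testFunction_deriv_eq {a b : ℝ} {ψ : ℝ → ℝ} (hψ : ContDiff ℝ ∞ ψ)
    (hc : HasCompactSupport ψ) (hs : tsupport ψ ⊆ Ioo a b) (h0 : ∫ x in a..b, ψ x = 0) :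
    ∃ φ : ℝ → ℝ, ContDiff ℝ ∞ φ ∧ HasCompactSupport φ ∧ tsupport φ ⊆ Ioo a b ∧ deriv φ = ψ := by
  rcases (tsupport ψ).eq_empty_or_nonempty with he | hne
  · have : ψ = 0 := tsupport_eq_empty_iff.1 he
    refine ⟨0, contDiff_const, HasCompactSupport.zero, by simp, ?_⟩
    rw [this]; ext x; simp
  obtain ⟨c, hc1⟩ := hc.isCompact.exists_isLeast hne
  obtain ⟨d, hd1⟩ := hc.isCompact.exists_isGreatest hne
  have hcI := hs hc1.1
  have hdI := hs hd1.1
  have hzero : ∀ x, x ∉ Icc c d → ψ x = 0 := by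
    intro x hx
    by_contra h
    exact hx ⟨hc1.2 (subset_tsupport _ h), hd1.2 (subset_tsupport _ h)⟩
  have hderiv : ∀ x, HasDerivAt (fun x => ∫ t in a..x, ψ t) (ψ x) x := fun x =>
    intervalIntegral.integral_hasDerivAt_right (hψ.continuous.intervalIntegrable _ _)
      (hψ.continuous.stronglyMeasurableAtFilter _ _) hψ.continuous.continuousAt
  have hd : deriv (fun x => ∫ t in a..x, ψ t) = ψ := funext fun x => (hderiv x).deriv
  -- To the left of the support the integrand vanishes; to the right of it the primitive equals the
  -- full integral over `a..b`, which is zero by `h0`.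
  have hz : ∀ x, x ∉ Icc c d → (fun x => ∫ t in a..x, ψ t) x = 0 := by
    intro x hx
    have hcd : c ≤ d := hc1.2 hd1.1
    rcases lt_or_ge x c with h | h
    · show ∫ t in a..x, ψ t = 0
      rw [intervalIntegral.integral_congr (g := fun _ => 0)]
      · simp
      · intro t ht
        apply hzero
        rintro ⟨h1, h2⟩
        rcases mem_uIcc.1 ht with h3 | h3 <;> linarith [h3.1, h3.2, hcI.1]
    · have hdx : d < x := by
        by_contra h'; exact hx ⟨h, not_lt.1 h'⟩
      have : ∫ t in b..x, ψ t = 0 := by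
        rw [intervalIntegral.integral_congr (g := fun _ => 0)]
        · simp
        · intro t ht
          apply hzero
          rintro ⟨h1, h2⟩
          rcases mem_uIcc.1 ht with h3 | h3 <;> linarith [h3.1, h3.2, hdI.2]
      show ∫ t in a..x, ψ t = 0
      rw [← intervalIntegral.integral_add_adjacent_intervals (b := b)
        (hψ.continuous.intervalIntegrable _ _) (hψ.continuous.intervalIntegrable _ _), h0, this,
        add_zero]
  refine ⟨fun x => ∫ t in a..x, ψ t, ?_, HasCompactSupport.intro isCompact_Icc hz, ?_, hd⟩
  · rw [contDiff_infty_iff_deriv, hd]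
    exact ⟨fun x => (hderiv x).differentiableAt, hψ⟩
  · refine (closure_minimal (fun x hx => ?_) isClosed_Icc).trans (Icc_subset_Ioo hcI.1 hdI.2)
    by_contra h
    exact hx (hz x h)

/-- **The lemma of du Bois-Reymond**. -/
lemma ae_eq_const_of_integral_deriv_mul_eq_zero {a b : ℝ} (hab : a < b) {w : ℝ → ℝ}
    (hw : IntervalIntegrable w volume a b)
    (h : ∀ φ : ℝ → ℝ, ContDiff ℝ ∞ φ → HasCompactSupport φ → tsupport φ ⊆ Ioo a b →
      ∫ x in a..b, deriv φ x * w x = 0) :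
    ∃ c, ∀ᵐ x, x ∈ Ioo a b → w x = c := by
  obtain ⟨ρ, hρ, hρc, hρs, hρ1⟩ : ∃ ρ : ℝ → ℝ, ContDiff ℝ ∞ ρ ∧ HasCompactSupport ρ ∧
      tsupport ρ ⊆ Ioo a b ∧ ∫ x in a..b, ρ x = 1 := by
    let f : ContDiffBump ((a + b) / 2) :=
      ⟨(b - a) / 8, (b - a) / 4, by linarith, by linarith⟩
    have hs : tsupport (f.normed volume) ⊆ Ioo a b := by
      rw [f.tsupport_normed_eq, Real.closedBall_eq_Icc]
      apply Icc_subset_Ioo <;> simp only [f] <;> linarith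
    refine ⟨f.normed volume, f.contDiff_normed, f.hasCompactSupport_normed, hs, ?_⟩
    rw [intervalIntegral.integral_eq_integral_of_support_subset, f.integral_normed]
    exact (subset_tsupport _).trans (hs.trans Ioo_subset_Ioc_self)
  have hcont : ∀ {ψ : ℝ → ℝ}, Continuous ψ → IntervalIntegrable (fun x => ψ x * w x) volume a b :=
    fun hψ => hw.continuousOn_mul hψ.continuousOn
  -- Every test function ψ is (∫ψ)ρ plus the derivative of a test function, so ∫ψw = (∫ψ)(∫ρw). This
  -- identifies the constant.
  set c := ∫ x in a..b, ρ x * w x with hcdef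
  refine ⟨c, ?_⟩
  have hwI : IntegrableOn w (Ioo a b) :=
    ((intervalIntegrable_iff_integrableOn_Ioc_of_le hab.le).1 hw).mono_set Ioo_subset_Ioc_self
  have key := isOpen_Ioo.ae_eq_zero_of_integral_contDiff_smul_eq_zero (U := Ioo a b)
    (f := fun x => w x - c) (μ := volume)
    ((hwI.sub (integrableOn_const (by simp) (by simp))).locallyIntegrableOn) ?_
  · filter_upwards [key] with x hx hxI
    linarith [hx hxI]
  intro ψ hψ hψc hψs
  set m := ∫ x in a..b, ψ x with hm
  have hi : ∀ {ψ : ℝ → ℝ}, ContDiff ℝ ∞ ψ → IntervalIntegrable ψ volume a b :=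
    fun hψ => hψ.continuous.intervalIntegrable _ _
  have hsub : tsupport (fun x => ψ x - m * ρ x) ⊆ tsupport ψ ∪ tsupport ρ := by
    refine closure_minimal (fun x hx => ?_) ((isClosed_tsupport _).union (isClosed_tsupport _))
    by_contra h'
    rw [mem_union, not_or] at h'
    apply hx
    simp [image_eq_zero_of_notMem_tsupport h'.1, image_eq_zero_of_notMem_tsupport h'.2]
  have hφ0 : ∫ x in a..b, (ψ x - m * ρ x) = 0 := by
    rw [intervalIntegral.integral_sub (hi hψ) ((hi hρ).const_mul _),
      intervalIntegral.integral_const_mul, hρ1]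
    simp [hm]
  obtain ⟨φ, h1, h2, h3, h4⟩ := exists_testFunction_deriv_eq (a := a) (b := b)
    (hψ.sub (contDiff_const.mul hρ))
    (IsCompact.of_isClosed_subset (hψc.isCompact.union hρc.isCompact) (isClosed_tsupport _) hsub)
    (hsub.trans (union_subset hψs hρs)) hφ0
  have h5 := h φ h1 h2 h3
  rw [h4] at h5
  have hsupp : Function.support (fun x => ψ x • (w x - c)) ⊆ Ioc a b := by
    intro x hx
    refine Ioo_subset_Ioc_self (hψs (subset_tsupport _ fun h0 => hx ?_))
    simp [h0]
  rw [← intervalIntegral.integral_eq_integral_of_support_subset hsupp]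
  have e1 : ∀ x, (ψ x - m * ρ x) * w x = ψ x * w x - m * (ρ x * w x) := fun x => by ring
  have e2 : ∀ x, ψ x • (w x - c) = ψ x * w x - ψ x * c := fun x => by
    rw [smul_eq_mul]; ring
  simp_rw [e1] at h5
  simp_rw [e2]
  rw [intervalIntegral.integral_sub (hcont hψ.continuous)
    ((hcont hρ.continuous).const_mul _), intervalIntegral.integral_const_mul] at h5
  rw [intervalIntegral.integral_sub (hcont hψ.continuous) ((hi hψ).mul_const _),
    intervalIntegral.integral_mul_const]
  exact h5

/-- A function on an interval with integrable weak derivative is a primitive of it. -/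
lemma ae_eq_const_add_integral_of_weakDeriv {a b : ℝ} (hab : a < b) {u g : ℝ → ℝ}
    (hu : IntervalIntegrable u volume a b) (hg : IntervalIntegrable g volume a b)
    (h : ∀ φ : ℝ → ℝ, ContDiff ℝ ∞ φ → HasCompactSupport φ → tsupport φ ⊆ Ioo a b →
      ∫ x in a..b, deriv φ x * u x = -∫ x in a..b, φ x * g x) :
    ∃ c, ∀ᵐ x, x ∈ Ioo a b → u x = c + ∫ t in a..x, g t := by
  have hG : AbsolutelyContinuousOnInterval (fun x => ∫ t in a..x, g t) a b :=
    hg.absolutelyContinuousOnInterval_intervalIntegral (by simp)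
  have hGi : IntervalIntegrable (fun x => ∫ t in a..x, g t) volume a b :=
    hG.continuousOn.intervalIntegrable
  -- The primitive of `g` has weak derivative `g` by integration by parts for absolutely continuous
  -- functions, so `u` minus this primitive has weak derivative zero.
  suffices H : ∀ φ : ℝ → ℝ, ContDiff ℝ ∞ φ → HasCompactSupport φ → tsupport φ ⊆ Ioo a b →
      ∫ x in a..b, deriv φ x * (u x - ∫ t in a..x, g t) = 0 by
    obtain ⟨c, hc⟩ := ae_eq_const_of_integral_deriv_mul_eq_zero hab (hu.sub hGi) H
    refine ⟨c, ?_⟩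
    filter_upwards [hc] with x hx hxI
    have := hx hxI
    linarith
  intro φ hφ hφc hφs
  have hφ' : Continuous (deriv φ) := hφ.continuous_deriv (by simp)
  have hφAC : AbsolutelyContinuousOnInterval φ a b :=
    (hφ.of_le (by simp)).contDiffOn.absolutelyContinuousOnInterval
  have hend : ∀ x, x ∉ Ioo a b → φ x = 0 := fun x hx =>
    image_eq_zero_of_notMem_tsupport fun h' => hx (hφs h')
  have parts := hφAC.integral_deriv_mul_eq_sub hG
  have hae : ∫ x in a..b, (deriv φ x * (∫ t in a..x, g t) +
      φ x * deriv (fun x => ∫ t in a..x, g t) x) =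
      ∫ x in a..b, (deriv φ x * (∫ t in a..x, g t) + φ x * g x) := by
    apply intervalIntegral.integral_congr_ae
    filter_upwards [hg.ae_hasDerivAt_integral] with x hx hxI
    rw [(hx (uIoc_subset_uIcc hxI) a (by simp)).deriv]
  rw [hae, hend a (by simp), hend b (by simp), zero_mul, zero_mul, sub_zero,
    intervalIntegral.integral_add (hGi.continuousOn_mul hφ'.continuousOn)
    (hg.continuousOn_mul hφ.continuous.continuousOn)] at parts
  simp only [mul_sub]
  rw [intervalIntegral.integral_sub (hu.continuousOn_mul hφ'.continuousOn)
    (hGi.continuousOn_mul hφ'.continuousOn), h φ hφ hφc hφs]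
  linarith

lemma InL2.intervalIntegrable {g : ℝ → Plane} (hg : InL2 g) :
    IntervalIntegrable g volume 0 (2 * Real.pi) := by
  rw [intervalIntegrable_iff_integrableOn_Ioo_of_le Real.two_pi_pos.le]
  exact MemLp.integrable (by norm_num) hg

lemma intervalIntegrable_coord {a b : ℝ} {g : ℝ → Plane} (hg : IntervalIntegrable g volume a b)
    (i : Fin 2) : IntervalIntegrable (fun x => g x i) volume a b :=
  ⟨(EuclideanSpace.proj i : Plane →L[ℝ] ℝ).integrable_comp hg.1,
    (EuclideanSpace.proj i : Plane →L[ℝ] ℝ).integrable_comp hg.2⟩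

lemma intervalIntegral_coord {a b : ℝ} {g : ℝ → Plane} (hg : IntervalIntegrable g volume a b)
    (i : Fin 2) : (∫ x in a..b, g x) i = ∫ x in a..b, g x i :=
  ((EuclideanSpace.proj i : Plane →L[ℝ] ℝ).intervalIntegral_comp_comm hg).symm

/-- Version of `ae_eq_const_add_integral_of_weakDeriv` for the plane. -/
lemma HasWeakDeriv.ae_eq {u g : ℝ → Plane} (h : HasWeakDeriv u g)
    (hu : IntervalIntegrable u volume 0 (2 * Real.pi))
    (hg : IntervalIntegrable g volume 0 (2 * Real.pi)) :
    ∃ c : Plane, ∀ᵐ x, x ∈ Ioo 0 (2 * Real.pi) → u x = c + ∫ t in (0 : ℝ)..x, g t := by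
  have key : ∀ i : Fin 2, ∃ c : ℝ, ∀ᵐ x, x ∈ Ioo 0 (2 * Real.pi) →
      u x i = c + ∫ t in (0 : ℝ)..x, g t i := by
    intro i
    refine ae_eq_const_add_integral_of_weakDeriv Real.two_pi_pos (intervalIntegrable_coord hu i)
      (intervalIntegrable_coord hg i) fun φ hφ hφc hφs => ?_
    have h1 := congrArg (fun v : Plane => v i) (h φ hφ hφc hφs)
    have hφ' : Continuous (deriv φ) := hφ.continuous_deriv (by simp)
    simp only [PiLp.neg_apply] at h1
    rwa [intervalIntegral_coord (hu.continuousOn_smul hφ'.continuousOn),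
      intervalIntegral_coord (hg.continuousOn_smul hφ.continuous.continuousOn)] at h1
  obtain ⟨c0, h0⟩ := key 0
  obtain ⟨c1, h1⟩ := key 1
  refine ⟨!₂[c0, c1], ?_⟩
  filter_upwards [h0, h1] with x h0 h1 hx
  have hgx : IntervalIntegrable g volume 0 x := hg.mono_set (by
    rw [uIcc_of_le hx.1.le, uIcc_of_le Real.two_pi_pos.le]
    exact Icc_subset_Icc le_rfl hx.2.le)
  ext i
  rw [PiLp.add_apply, intervalIntegral_coord hgx]
  fin_cases i
  · simpa using h0 hx
  · simpa using h1 hx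

lemma continuousOn_primitive {g : ℝ → Plane} (hg : IntervalIntegrable g volume 0 (2 * Real.pi)) :
    ContinuousOn (fun x => ∫ t in (0 : ℝ)..x, g t) I := by
  have := intervalIntegral.continuousOn_primitive_interval (a := 0) (b := 2 * Real.pi)
    (f := g) (μ := volume) (by
      rw [uIcc_of_le Real.two_pi_pos.le, integrableOn_Icc_iff_integrableOn_Ioc]
      exact (intervalIntegrable_iff_integrableOn_Ioc_of_le Real.two_pi_pos.le).1 hg)
  rwa [uIcc_of_le Real.two_pi_pos.le] at this

lemma eqOn_I_of_ae {u w : ℝ → Plane} (hu : ContinuousOn u I) (hw : ContinuousOn w I)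
    (h : ∀ᵐ x, x ∈ Ioo 0 (2 * Real.pi) → u x = w x) : EqOn u w I := by
  refine Measure.eqOn_Icc_of_ae_eq volume Real.two_pi_pos.ne ?_ hu hw
  rw [← restrict_Ioo_eq_restrict_Icc]
  exact (ae_restrict_iff' measurableSet_Ioo).2 h

lemma HasWeakDeriv.eq_add_integral {u g : ℝ → Plane} (h : HasWeakDeriv u g)
    (hu : ContinuousOn u I) (hg : IntervalIntegrable g volume 0 (2 * Real.pi)) :
    ∀ x ∈ I, u x = u 0 + ∫ t in (0 : ℝ)..x, g t := by
  have hui : IntervalIntegrable u volume 0 (2 * Real.pi) :=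
    ContinuousOn.intervalIntegrable (by rwa [uIcc_of_le Real.two_pi_pos.le])
  obtain ⟨c, hc⟩ := h.ae_eq hui hg
  have he := eqOn_I_of_ae hu (continuousOn_const.add (continuousOn_primitive hg)) hc
  have h0 := he (x := 0) (by simp [I, Real.pi_pos.le])
  have h0' : u 0 = c := by simpa using h0
  intro x hx
  rw [h0', he hx]
  simp

lemma uniqueDiffOn_I : UniqueDiffOn ℝ I := uniqueDiffOn_Icc Real.two_pi_pos

lemma I_mem_nhds {x : ℝ} (hx : x ∈ Ioo 0 (2 * Real.pi)) : I ∈ nhds x := Icc_mem_nhds hx.1 hx.2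

lemma D_eq_of_hasDerivAt {u : ℝ → Plane} {x : ℝ} {d : Plane} (hx : x ∈ I)
    (h : HasDerivAt u d x) : D u x = d :=
  h.hasDerivWithinAt.derivWithin (uniqueDiffOn_I x hx)

/-! ### Sobolev functions as primitives -/

/-- `u` is the primitive on `[0, 2π]` of the square integrable function `g`. -/
structure IsPrimitive (u g : ℝ → Plane) : Prop where
  inL2 : InL2 g
  eq_add : ∀ x ∈ I, u x = u 0 + ∫ t in (0 : ℝ)..x, g t

lemma IsH1.exists_isPrimitive {u : ℝ → Plane} (h : IsH1 u) : ∃ g, IsPrimitive u g := by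
  obtain ⟨hc, g, hg, hw⟩ := h
  exact ⟨g, hg, hw.eq_add_integral hc hg.intervalIntegrable⟩

lemma IsPrimitive.ae_hasDerivAt {u g : ℝ → Plane} (h : IsPrimitive u g) :
    ∀ᵐ x, x ∈ Ioo 0 (2 * Real.pi) → HasDerivAt u (g x) x := by
  filter_upwards [h.inL2.intervalIntegrable.ae_hasDerivAt_integral] with x hx hxI
  have h1 := hx (by rw [uIcc_of_le Real.two_pi_pos.le]; exact Ioo_subset_Icc_self hxI) 0 (by simp)
  refine (h1.const_add (u 0)).congr_of_eventuallyEq ?_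
  filter_upwards [I_mem_nhds hxI] with y hy using h.eq_add y hy

lemma IsPrimitive.continuousOn {u g : ℝ → Plane} (h : IsPrimitive u g) : ContinuousOn u I :=
  (continuousOn_const.add (continuousOn_primitive h.inL2.intervalIntegrable)).congr h.eq_add

lemma _root_.AbsolutelyContinuousOnInterval.congr {f g : ℝ → ℝ} {a b : ℝ}
    (hf : AbsolutelyContinuousOnInterval f a b) (h : EqOn g f (uIcc a b)) :
    AbsolutelyContinuousOnInterval g a b := by
  rw [absolutelyContinuousOnInterval_iff] at hf ⊢
  intro ε hε
  obtain ⟨d, hd, H⟩ := hf ε hε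
  refine ⟨d, hd, fun E hE hs => ?_⟩
  convert H E hE hs using 2 with i hi
  rw [h (hE.1 i (by simpa using hi)).1, h (hE.1 i (by simpa using hi)).2]

/-- This is the form in which H¹ regularity enters later: products are formed, integrated by parts
and shown to be constant coordinate by coordinate. -/
lemma IsPrimitive.absolutelyContinuous {u g : ℝ → Plane} (h : IsPrimitive u g) (i : Fin 2) :
    AbsolutelyContinuousOnInterval (fun x => u x i) 0 (2 * Real.pi) := by
  have h1 := (intervalIntegrable_coord h.inL2.intervalIntegrable
    i).absolutelyContinuousOnInterval_intervalIntegral (c := 0) (by simp)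
  have hconst : AbsolutelyContinuousOnInterval (fun _ : ℝ => u 0 i) 0 (2 * Real.pi) :=
    (LipschitzWith.const (u 0 i)).lipschitzOnWith.absolutelyContinuousOnInterval
  refine (hconst.add h1).congr fun x hx => ?_
  rw [uIcc_of_le Real.two_pi_pos.le] at hx
  have hgx : IntervalIntegrable g volume 0 x := h.inL2.intervalIntegrable.mono_set (by
    rw [uIcc_of_le hx.1, uIcc_of_le Real.two_pi_pos.le]
    exact Icc_subset_Icc le_rfl hx.2)
  simp only [Pi.add_apply]
  rw [h.eq_add x hx, PiLp.add_apply, intervalIntegral_coord hgx]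

/-- An `H²` function is continuously differentiable with derivative in `H¹`. -/
lemma IsH2.hasDerivWithinAt {u : ℝ → Plane} (h : IsH2 u) :
    (∀ x ∈ I, HasDerivWithinAt u (D u x) I x) ∧ ∃ k, IsPrimitive (D u) k := by
  obtain ⟨hc, g, k, hg, hk, hug, hgk⟩ := h
  have hgi := hg.intervalIntegrable
  have hki := hk.intervalIntegrable
  obtain ⟨c, hcg⟩ := hgk.ae_eq hgi hki
  have hu := hug.eq_add_integral hc hgi
  -- The continuous representative of the first weak derivative `g`. Replacing `g` by it under the
  -- integral makes the fundamental theorem available at every point, end points included.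
  set w : ℝ → Plane := fun x => c + ∫ t in (0 : ℝ)..x, k t with hw
  have hwc : ContinuousOn w I := continuousOn_const.add (continuousOn_primitive hki)
  have hu' : ∀ x ∈ I, u x = u 0 + ∫ t in (0 : ℝ)..x, w t := by
    intro x hx
    rw [hu x hx]
    congr 1
    apply intervalIntegral.integral_congr_ae
    have hne : ∀ᵐ t : ℝ, t ≠ 2 * Real.pi := by simp [ae_iff]
    filter_upwards [hcg, hne] with t ht hne htI
    rw [uIoc_of_le hx.1] at htI
    exact ht ⟨htI.1, lt_of_le_of_ne (htI.2.trans hx.2) hne⟩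
  have hd : ∀ x ∈ I, HasDerivWithinAt u (w x) I x := by
    intro x hx
    have hwx : IntervalIntegrable w volume 0 x := (hwc.mono (by
      rw [uIcc_of_le hx.1]; exact Icc_subset_Icc le_rfl hx.2)).intervalIntegrable
    have : Fact (x ∈ Icc 0 (2 * Real.pi)) := ⟨hx⟩
    have h1 : HasDerivWithinAt (fun y => ∫ t in (0 : ℝ)..y, w t) (w x) I x := by
      exact intervalIntegral.integral_hasDerivWithinAt_right (s := Icc 0 (2 * Real.pi))
        (t := Icc 0 (2 * Real.pi)) hwx
        (hwc.stronglyMeasurableAtFilter_nhdsWithin measurableSet_Icc x) (hwc x hx)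
    exact (h1.const_add (u 0)).congr hu' (hu' x hx)
  have hDw : ∀ x ∈ I, D u x = w x := fun x hx => (hd x hx).derivWithin (uniqueDiffOn_I x hx)
  refine ⟨fun x hx => by rw [hDw x hx]; exact hd x hx, k, hk, fun x hx => ?_⟩
  rw [hDw x hx, hDw 0 (by simp [I, Real.pi_pos.le])]
  simp [hw]

/-- Continuously differentiable functions have their derivative as weak derivative. -/
lemma hasWeakDeriv_of_hasDerivAt {u u' : ℝ → Plane} (h : ∀ x, HasDerivAt u (u' x) x)
    (hc : Continuous u') : HasWeakDeriv u u' := by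
  intro φ hφ hφc hφs
  have hend : ∀ x, x ∉ Ioo 0 (2 * Real.pi) → φ x = 0 := fun x hx =>
    image_eq_zero_of_notMem_tsupport fun h' => hx (hφs h')
  have hφ' : Continuous (deriv φ) := hφ.continuous_deriv (by simp)
  have hu : Continuous u := continuous_iff_continuousAt.2 fun x => (h x).continuousAt
  have hd : ∀ x, HasDerivAt (fun x => φ x • u x) (φ x • u' x + deriv φ x • u x) x := fun x =>
    ((hφ.differentiable (by simp)) x).hasDerivAt.smul (h x)
  have h1 := intervalIntegral.integral_eq_sub_of_hasDerivAt (a := 0) (b := 2 * Real.pi)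
    (fun x _ => hd x)
    ((((hφ.continuous.smul hc).add (hφ'.smul hu))).intervalIntegrable _ _)
  rw [intervalIntegral.integral_add (f := fun x => φ x • u' x) (g := fun x => deriv φ x • u x)
    ((hφ.continuous.smul hc).intervalIntegrable _ _)
    ((hφ'.smul hu).intervalIntegrable _ _), hend 0 (by simp), hend (2 * Real.pi) (by simp)] at h1
  simp only [zero_smul, sub_zero] at h1
  exact eq_neg_of_add_eq_zero_right h1

lemma memLp_of_continuousOn {E : Type*} [NormedAddCommGroup E] [SecondCountableTopology E]
    {f : ℝ → E} (hf : ContinuousOn f I) (p : ENNReal) :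
    MemLp f p (volume.restrict (Ioo 0 (2 * Real.pi))) := by
  obtain ⟨C, hC⟩ := isCompact_Icc.exists_bound_of_continuousOn hf
  refine MemLp.of_bound ((hf.mono Ioo_subset_Icc_self).aestronglyMeasurable measurableSet_Ioo) C ?_
  exact (ae_restrict_iff' measurableSet_Ioo).2
    (Filter.Eventually.of_forall fun x hx => hC x (Ioo_subset_Icc_self hx))

lemma inL2_of_continuous {u : ℝ → Plane} (hu : Continuous u) : InL2 u :=
  memLp_of_continuousOn hu.continuousOn 2

/-! ### Wirtinger's inequality -/

/-- **Wirtinger's inequality** for complex valued functions, with the case of equality. -/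
lemma wirtinger_complex {f f' : ℝ → ℂ} (hf : ∀ x, HasDerivAt f (f' x) x) (hf' : Continuous f')
    (hper : f 0 = f (2 * Real.pi)) (hmean : ∫ x in (0 : ℝ)..(2 * Real.pi), f x = 0) :
    (∫ x in (0 : ℝ)..(2 * Real.pi), ‖f x‖ ^ 2) ≤ ∫ x in (0 : ℝ)..(2 * Real.pi), ‖f' x‖ ^ 2 ∧
    ((∫ x in (0 : ℝ)..(2 * Real.pi), ‖f x‖ ^ 2) = (∫ x in (0 : ℝ)..(2 * Real.pi), ‖f' x‖ ^ 2) →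
      ∃ A B : ℂ, ∀ x ∈ I, f x = A * Complex.exp (Complex.I * x) +
        B * Complex.exp (-(Complex.I * x))) := by
  have hpi := Real.two_pi_pos
  have hfc : Continuous f := continuous_iff_continuousAt.2 fun x => (hf x).continuousAt
  have hL : ∀ {g : ℝ → ℂ}, Continuous g → MemLp g 2 (volume.restrict (Ioc 0 (2 * Real.pi))) := by
    intro g hg
    rw [← restrict_Ioo_eq_restrict_Ioc]
    exact memLp_of_continuousOn hg.continuousOn 2
  have h1 := hasSum_sq_fourierCoeffOn hpi (hL hfc)
  have h2 := hasSum_sq_fourierCoeffOn hpi (hL hf')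
  set c := fourierCoeffOn hpi f with hc
  set c' := fourierCoeffOn hpi f' with hc'
  have hc0 : c 0 = 0 := by
    rw [hc, fourierCoeffOn_eq_integral]
    simp [hmean]
  -- For n ≠ 0 periodicity removes the boundary term, so c'ₙ = i n cₙ. The mode n = 0 is treated
  -- apart; there c₀ = 0 by the mean condition. With Parseval, the difference of the two sides of
  -- the inequality is a series of nonnegative terms.
  have hrel : ∀ n : ℤ, ‖c' n‖ ^ 2 - ‖c n‖ ^ 2 = if n = 0 then ‖c' 0‖ ^ 2 else
      ((n : ℝ) ^ 2 - 1) * ‖c n‖ ^ 2 := by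
    intro n
    split_ifs with hn
    · simp [hn, hc0]
    · have h3 := fourierCoeffOn_of_hasDerivAt hpi hn (fun x _ => hf x)
        (hf'.intervalIntegrable 0 (2 * Real.pi))
      rw [← hc, ← hc', ← hper] at h3
      have h4 : c' n = Complex.I * n * c n := by
        have hpc : (Real.pi : ℂ) ≠ 0 := by exact_mod_cast Real.pi_ne_zero
        have hnc : (n : ℂ) ≠ 0 := by exact_mod_cast hn
        rw [h3]
        push_cast
        field_simp
        ring
      rw [h4]
      simp only [norm_mul, Complex.norm_I, one_mul, Complex.norm_intCast]
      rw [mul_pow, sq_abs]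
      ring
  have hnn : ∀ n : ℤ, 0 ≤ ‖c' n‖ ^ 2 - ‖c n‖ ^ 2 := by
    intro n
    rw [hrel]
    split_ifs with hn
    · positivity
    · have : (1 : ℝ) ≤ (n : ℝ) ^ 2 := by
        have : (1 : ℤ) ≤ n ^ 2 := by
          have := sq_pos_of_ne_zero hn
          omega
        exact_mod_cast this
      exact mul_nonneg (by linarith) (sq_nonneg _)
  have h3 := h2.sub h1
  simp only [sub_zero, smul_eq_mul, ← mul_sub] at h3
  have hle := h3.nonneg hnn
  have hpi' : 0 < (2 * Real.pi)⁻¹ := inv_pos.2 hpi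
  refine ⟨by have := nonneg_of_mul_nonneg_right hle hpi'; linarith, fun heq => ?_⟩
  rw [heq, sub_self, mul_zero, hasSum_zero_iff_of_nonneg hnn] at h3
  -- In the case of equality each term (n²-1)|cₙ|² vanishes, which leaves the modes ±1.
  have hcn : ∀ n : ℤ, n ≠ 1 → n ≠ -1 → c n = 0 := by
    intro n hn1 hn2
    by_cases hn : n = 0
    · rw [hn, hc0]
    have h4 := congrFun h3 n
    rw [hrel, if_neg hn, Pi.zero_apply] at h4
    have h5 : (n : ℝ) ^ 2 - 1 ≠ 0 := by
      intro h
      have : (n : ℝ) ^ 2 = 1 := by linarith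
      rcases mul_self_eq_one_iff.1 ((sq _).symm.trans this) with h' | h'
      · exact hn1 (by exact_mod_cast h')
      · exact hn2 (by exact_mod_cast h')
    simpa using (mul_eq_zero.1 h4).resolve_left h5
  have : Fact (0 < 2 * Real.pi) := ⟨hpi⟩
  -- Only finitely many coefficients survive, so the Fourier series of this continuous function
  -- converges to it pointwise, not merely in L².
  let F : C(AddCircle (2 * Real.pi), ℂ) :=
    ⟨AddCircle.liftIco (2 * Real.pi) 0 f,
      AddCircle.liftIco_continuous (by simpa using hper) hfc.continuousOn⟩
  have hFc : ∀ n, fourierCoeff F n = c n := by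
    intro n
    have := fourierCoeff_liftIco_eq (T := 2 * Real.pi) (a := 0) f n
    simp only [F, ContinuousMap.coe_mk]
    rw [this, hc]
    congr 1; simp
  have hsum := has_pointwise_sum_fourier_series_of_summable (f := F)
    (summable_of_ne_finset_zero (s := {1, -1}) fun n hn => by
      rw [hFc]
      simp only [Finset.mem_insert, Finset.mem_singleton, not_or] at hn
      exact hcn n hn.1 hn.2)
  have hIco : ∀ x ∈ Ico 0 (2 * Real.pi), f x = c 1 * Complex.exp (Complex.I * x) +
        c (-1) * Complex.exp (-(Complex.I * x)) := by
    intro x hx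
    have h5 := (hsum (x : AddCircle (2 * Real.pi))).unique (hasSum_sum_of_ne_finset_zero
      (s := {1, -1}) fun n hn => by
        simp only [Finset.mem_insert, Finset.mem_singleton, not_or] at hn
        rw [hFc, hcn n hn.1 hn.2, zero_smul])
    have h6 : F (x : AddCircle (2 * Real.pi)) = f x :=
      AddCircle.liftIco_coe_apply (by simpa using hx)
    rw [← h6, h5, Finset.sum_pair (by norm_num), hFc, hFc]
    simp only [fourier_coe_apply, smul_eq_mul]
    have hpc : (Real.pi : ℂ) ≠ 0 := by exact_mod_cast Real.pi_ne_zero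
    congr 3
    · push_cast; field_simp
    · push_cast; field_simp
  refine ⟨c 1, c (-1), fun x hx => ?_⟩
  rcases hx.2.lt_or_eq with h | h
  · exact hIco x ⟨hx.1, h⟩
  · rw [h, ← hper, hIco 0 ⟨le_rfl, hpi⟩]
    have e : Complex.I * ((2 * Real.pi : ℝ) : ℂ) = 2 * Real.pi * Complex.I := by
      push_cast; ring
    have e' : Complex.exp (-(2 * Real.pi * Complex.I)) = 1 := by
      rw [Complex.exp_neg, Complex.exp_two_pi_mul_I, inv_one]
    rw [e, e', Complex.exp_two_pi_mul_I]
    simp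

/-- The arc length of the curve `γ` between the parameters `0` and `x`. -/
def arcLength (γ : ℝ → Plane) (x : ℝ) : ℝ := ∫ t in (0 : ℝ)..x, ‖D γ t‖

lemma length_eq_arcLength (γ : ℝ → Plane) : length γ = arcLength γ (2 * Real.pi) := by
  simp [length, lineIntegral, arcLength]

/-- **Wirtinger's inequality** for a closed regular curve in terms of its arc length, with the
case of equality. -/
lemma wirtinger_arcLength {γ : ℝ → Plane} (hd : ∀ x ∈ I, HasDerivWithinAt γ (D γ x) I x)
    (hw : ContinuousOn (D γ) I) (hne : ∀ x ∈ I, D γ x ≠ 0) (hper : γ 0 = γ (2 * Real.pi)) :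
    0 < length γ ∧ ∃ p : Plane,
      (2 * Real.pi / length γ) ^ 2 *
        (∫ x in (0 : ℝ)..(2 * Real.pi), ‖γ x - p‖ ^ 2 * ‖D γ x‖) ≤ length γ ∧
      ((2 * Real.pi / length γ) ^ 2 *
        (∫ x in (0 : ℝ)..(2 * Real.pi), ‖γ x - p‖ ^ 2 * ‖D γ x‖) = length γ →
      ∃ a b : Plane, ∀ x ∈ I, γ x = p +
        Real.cos (2 * Real.pi / length γ * arcLength γ x) • a +
        Real.sin (2 * Real.pi / length γ * arcLength γ x) • b) := by
  have hpi := Real.two_pi_pos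
  -- Extending the velocity by its boundary values keeps it continuous and its norm bounded below on
  -- all of ℝ. The rescaled arc length σ is then a global bijection with a differentiable inverse,
  -- and no one-sided derivatives occur.
  set W : ℝ → Plane := IccExtend hpi.le ((Icc 0 (2 * Real.pi)).domRestrict (D γ)) with hW
  have hWc : Continuous W := (continuousOn_iff_continuous_domRestrict.1 hw).Icc_extend'
  have hWI : ∀ x ∈ I, W x = D γ x := fun x hx => by
    rw [hW, IccExtend_of_mem _ _ hx]; rfl
  have hVc : Continuous fun x => ‖W x‖ := hWc.norm
  obtain ⟨m, hm, hVm⟩ : ∃ m > 0, ∀ x, m ≤ ‖W x‖ := by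
    obtain ⟨y, hy, hmin⟩ := isCompact_Icc.exists_isMinOn
      (nonempty_Icc.2 hpi.le) hw.norm
    refine ⟨‖D γ y‖, norm_pos_iff.2 (hne y hy), fun x => ?_⟩
    exact hmin (projIcc 0 (2 * Real.pi) hpi.le x).2
  have hI0 : (0 : ℝ) ∈ I := ⟨le_rfl, hpi.le⟩
  have hI1 : 2 * Real.pi ∈ I := ⟨hpi.le, le_rfl⟩
  have harc : ∀ x ∈ I, ∫ t in (0 : ℝ)..x, ‖W t‖ = arcLength γ x := by
    intro x hx
    refine intervalIntegral.integral_congr fun t ht => ?_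
    rw [uIcc_of_le hx.1] at ht
    show ‖W t‖ = ‖D γ t‖
    rw [hWI t ⟨ht.1, ht.2.trans hx.2⟩]
  have hlen : length γ = ∫ t in (0 : ℝ)..(2 * Real.pi), ‖W t‖ := by
    rw [length_eq_arcLength, harc _ hI1]
  have hLpos : 0 < length γ := by
    rw [hlen]
    exact intervalIntegral.intervalIntegral_pos_of_pos (hVc.intervalIntegrable _ _)
      (fun x => hm.trans_le (hVm x)) hpi
  refine ⟨hLpos, ?_⟩
  set q := 2 * Real.pi / length γ with hq
  have hqpos : 0 < q := div_pos hpi hLpos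
  have hqL : q * length γ = 2 * Real.pi := div_mul_cancel₀ _ hLpos.ne'
  set Γ : ℝ → Plane := fun x => γ 0 + ∫ t in (0 : ℝ)..x, W t with hΓ
  have hΓd : ∀ x, HasDerivAt Γ (W x) x := fun x =>
    (intervalIntegral.integral_hasDerivAt_right (hWc.intervalIntegrable _ _)
      (hWc.stronglyMeasurableAtFilter _ _) hWc.continuousAt).const_add _
  have hΓγ : ∀ x ∈ I, Γ x = γ x := by
    intro x hx
    have hd' : ∀ y ∈ Icc 0 (2 * Real.pi),
        HasDerivWithinAt (fun y => Γ y - γ y) 0 (Icc 0 (2 * Real.pi)) y := by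
      intro y hy
      have := (hΓd y).hasDerivWithinAt.sub (hd y hy)
      rwa [hWI y hy, sub_self] at this
    have := constant_of_derivWithin_zero (fun y hy => (hd' y hy).differentiableWithinAt)
      (fun y hy => (hd' y (Ico_subset_Icc_self hy)).derivWithin
        (uniqueDiffOn_I y (Ico_subset_Icc_self hy))) x hx
    simp only [hΓ, intervalIntegral.integral_same, add_zero, sub_self] at this
    exact sub_eq_zero.1 this
  -- Arc length scaled so that σ maps [0, 2π] onto itself; γ ∘ σ⁻¹ is then a 2π-periodic curve of
  -- constant speed 1/q.
  set σ : ℝ → ℝ := fun x => q * ∫ t in (0 : ℝ)..x, ‖W t‖ with hσ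
  have hσd : ∀ x, HasDerivAt σ (q * ‖W x‖) x := fun x =>
    (intervalIntegral.integral_hasDerivAt_right (hVc.intervalIntegrable _ _)
      (hVc.stronglyMeasurableAtFilter _ _) hVc.continuousAt).const_mul _
  have hσpos : ∀ x, 0 < q * ‖W x‖ := fun x => mul_pos hqpos (hm.trans_le (hVm x))
  have hσc : Continuous σ := continuous_iff_continuousAt.2 fun x => (hσd x).continuousAt
  have hσmono : StrictMono σ := strictMono_of_deriv_pos fun x => by
    rw [(hσd x).deriv]; exact hσpos x
  have hσ0 : σ 0 = 0 := by simp [hσ]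
  have hσ1 : σ (2 * Real.pi) = 2 * Real.pi := by
    simp only [hσ]; rw [← hlen, hqL]
  have hσsurj : Function.Surjective σ := by
    have hmn : Monotone fun x => σ x - q * m * x := by
      have hd' : ∀ x, HasDerivAt (fun x => σ x - q * m * x) (q * ‖W x‖ - q * m) x := fun x => by
        have := (hσd x).sub ((hasDerivAt_id x).const_mul (q * m))
        rwa [mul_one] at this
      refine monotone_of_deriv_nonneg (fun x => (hd' x).differentiableAt) fun x => ?_
      rw [(hd' x).deriv, sub_nonneg]
      exact mul_le_mul_of_nonneg_left (hVm x) hqpos.le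
    refine hσc.surjective ?_ ?_
    · refine Filter.tendsto_atTop_mono' _ ?_
        (Filter.tendsto_id.const_mul_atTop (mul_pos hqpos hm))
      filter_upwards [Filter.eventually_ge_atTop 0] with x hx
      have := hmn hx
      simp only [hσ0, mul_zero, sub_zero] at this
      simpa using this
    · refine Filter.tendsto_atBot_mono' _ ?_
        (Filter.tendsto_id.const_mul_atBot (mul_pos hqpos hm))
      filter_upwards [Filter.eventually_le_atBot 0] with x hx
      have := hmn hx
      simp only [hσ0, mul_zero, sub_zero] at this
      simpa using this
  let e := hσmono.orderIsoOfSurjective σ hσsurj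
  have hgc : Continuous e.symm := e.symm.continuous
  have hσg : ∀ t, σ (e.symm t) = t := fun t => e.apply_symm_apply t
  have hgσ : ∀ x, e.symm (σ x) = x := fun x => e.symm_apply_apply x
  have hgd : ∀ t, HasDerivAt e.symm (q * ‖W (e.symm t)‖)⁻¹ t := fun t =>
    HasDerivAt.of_local_left_inverse hgc.continuousAt (hσd _) (hσpos _).ne'
      (Filter.Eventually.of_forall hσg)
  have hg0 : e.symm 0 = 0 := by rw [← hσ0, hgσ, hσ0]
  have hg1 : e.symm (2 * Real.pi) = 2 * Real.pi := by
    conv_lhs => rw [← hσ1]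
    exact hgσ _
  let T := Complex.orthonormalBasisOneI.repr.symm
  have hΓc : Continuous Γ := continuous_iff_continuousAt.2 fun x => (hΓd x).continuousAt
  have hz : Continuous fun t => T (Γ (e.symm t)) := T.continuous.comp (hΓc.comp hgc)
  -- Subtracting the mean with respect to arc length gives the mean-zero function that Wirtinger
  -- requires; the point p of the statement is this mean.
  set c : ℂ := (2 * Real.pi)⁻¹ • ∫ t in (0 : ℝ)..(2 * Real.pi), T (Γ (e.symm t)) with hcdef
  set f : ℝ → ℂ := fun t => T (Γ (e.symm t)) - c with hf
  set f' : ℝ → ℂ := fun t => T ((q * ‖W (e.symm t)‖)⁻¹ • W (e.symm t)) with hf'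
  have hfd : ∀ t, HasDerivAt f (f' t) t := fun t =>
    ((T.toContinuousLinearEquiv : Plane →L[ℝ] ℂ).hasFDerivAt.comp_hasDerivAt t
      ((hΓd (e.symm t)).scomp t (hgd t))).sub_const c
  have hf'c : Continuous f' := T.continuous.comp
    (((continuous_const.mul (hVc.comp hgc)).inv₀ fun t => (hσpos _).ne').smul (hWc.comp hgc))
  have hfc : Continuous f := hz.sub continuous_const
  have hfper : f 0 = f (2 * Real.pi) := by
    simp only [hf, hg0, hg1, hΓγ _ hI0, hΓγ _ hI1, hper]
  have hfmean : ∫ t in (0 : ℝ)..(2 * Real.pi), f t = 0 := by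
    simp only [hf]
    rw [intervalIntegral.integral_sub (hz.intervalIntegrable _ _)
      (continuous_const.intervalIntegrable _ _), intervalIntegral.integral_const, hcdef, smul_smul,
      sub_zero, mul_inv_cancel₀ hpi.ne', one_smul, sub_self]
  obtain ⟨hle, heq⟩ := wirtinger_complex hfd hf'c hfper hfmean
  set p : Plane := T.symm c with hp
  have hfσ : ∀ x ∈ I, f (σ x) = T (γ x - p) := by
    intro x hx
    simp only [hf, hgσ, hΓγ x hx, map_sub, hp, LinearIsometryEquiv.apply_symm_apply]
  have hint1 : ∫ t in (0 : ℝ)..(2 * Real.pi), ‖f t‖ ^ 2 =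
      q * ∫ x in (0 : ℝ)..(2 * Real.pi), ‖γ x - p‖ ^ 2 * ‖D γ x‖ := by
    have h1 := intervalIntegral.integral_comp_mul_deriv' (a := 0) (b := 2 * Real.pi)
      (f := σ) (f' := fun x => q * ‖W x‖) (g := fun t => ‖f t‖ ^ 2) (fun x _ => hσd x)
      (continuous_const.mul hVc).continuousOn (hfc.norm.pow 2).continuousOn
    rw [hσ0, hσ1] at h1
    rw [← h1, ← intervalIntegral.integral_const_mul]
    refine intervalIntegral.integral_congr fun x hx => ?_
    rw [uIcc_of_le hpi.le] at hx
    simp only [Function.comp_apply]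
    rw [hfσ x hx, hWI x hx, LinearIsometryEquiv.norm_map]
    ring
  have hint2 : ∫ t in (0 : ℝ)..(2 * Real.pi), ‖f' t‖ ^ 2 = q⁻¹ * length γ := by
    have : ∀ t, ‖f' t‖ ^ 2 = (q⁻¹) ^ 2 := by
      intro t
      have hne0 : ‖W (e.symm t)‖ ≠ 0 := (hm.trans_le (hVm _)).ne'
      simp only [hf']
      rw [LinearIsometryEquiv.norm_map, norm_smul, norm_inv, norm_mul, norm_norm,
        Real.norm_of_nonneg hqpos.le]
      field_simp
    simp_rw [this]
    rw [intervalIntegral.integral_const, smul_eq_mul, sub_zero, ← hqL]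
    field_simp
  rw [hint1, hint2] at hle heq
  refine ⟨p, ?_, fun h => ?_⟩
  · calc _ = q * (q * ∫ x in (0 : ℝ)..(2 * Real.pi), ‖γ x - p‖ ^ 2 * ‖D γ x‖) := by ring
      _ ≤ q * (q⁻¹ * length γ) := mul_le_mul_of_nonneg_left hle hqpos.le
      _ = length γ := by field_simp
  · obtain ⟨A, B, hAB⟩ := heq (by rw [← h]; field_simp)
    refine ⟨T.symm (A + B), T.symm (Complex.I * (A - B)), fun x hx => ?_⟩
    have hσx : σ x ∈ I := ⟨by rw [← hσ0]; exact hσmono.monotone hx.1,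
      by rw [← hσ1]; exact hσmono.monotone hx.2⟩
    have h1 := hAB (σ x) hσx
    rw [hfσ x hx] at h1
    have h2 : γ x - p = T.symm (A * Complex.exp (Complex.I * (σ x)) +
        B * Complex.exp (-(Complex.I * (σ x)))) := by
      rw [← h1, LinearIsometryEquiv.symm_apply_apply]
    have h3 : A * Complex.exp (Complex.I * (σ x)) + B * Complex.exp (-(Complex.I * (σ x))) =
        Real.cos (σ x) • (A + B) + Real.sin (σ x) • (Complex.I * (A - B)) := by
      have e1 : Complex.I * (σ x : ℂ) = σ x * Complex.I := mul_comm _ _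
      rw [e1, ← neg_mul, Complex.exp_mul_I, Complex.exp_mul_I, Complex.cos_neg, Complex.sin_neg]
      simp only [Complex.real_smul, Complex.ofReal_cos, Complex.ofReal_sin]
      ring
    rw [h3, map_add, map_smul, map_smul] at h2
    rw [← harc x hx, add_assoc]
    exact sub_eq_iff_eq_add'.1 h2

/-! ### Plane geometry -/

lemma inner_plane (x y : Plane) : inner ℝ x y = x 0 * y 0 + x 1 * y 1 := by
  simp [PiLp.inner_apply, Fin.sum_univ_two, mul_comm]

lemma norm_sq_plane (x : Plane) : ‖x‖ ^ 2 = x 0 ^ 2 + x 1 ^ 2 := by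
  simp [EuclideanSpace.norm_sq_eq, Fin.sum_univ_two]

@[simp] lemma J_apply_zero (x : Plane) : J x 0 = -x 1 := rfl

@[simp] lemma J_apply_one (x : Plane) : J x 1 = x 0 := rfl

lemma plane_ext {x y : Plane} (h0 : x 0 = y 0) (h1 : x 1 = y 1) : x = y := by
  ext i
  fin_cases i
  · exact h0
  · exact h1

/-- The rotation `J` as a continuous linear map. -/
def JCLM : Plane →L[ℝ] Plane :=
  LinearMap.toContinuousLinearMap
    { toFun := J
      map_add' := fun x y => plane_ext (by simp [add_comm]) (by simp)
      map_smul' := fun c x => plane_ext (by simp) (by simp) }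

lemma JCLM_apply (x : Plane) : JCLM x = J x := rfl

lemma J_J (x : Plane) : J (J x) = -x := plane_ext (by simp) (by simp)

lemma norm_J (x : Plane) : ‖J x‖ = ‖x‖ := by
  rw [← sq_eq_sq₀ (norm_nonneg _) (norm_nonneg _), norm_sq_plane, norm_sq_plane]
  simp; ring

lemma inner_J_self (x : Plane) : inner ℝ x (J x) = 0 := by
  rw [inner_plane]; simp; ring

/-- A unit vector t and J t form an orthonormal basis; applied to t = τ it gives the moving frame τ,
ν. -/
lemma eq_inner_smul_add_inner_smul_J {t : Plane} (ht : ‖t‖ = 1) (x : Plane) :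
    x = (inner ℝ x t : ℝ) • t + (inner ℝ x (J t) : ℝ) • J t := by
  have h := norm_sq_plane t
  rw [ht] at h
  apply plane_ext
  · simp [inner_plane]; linear_combination x 0 * h
  · simp [inner_plane]; linear_combination x 1 * h

lemma norm_sq_eq_inner_sq_add_inner_J_sq {t : Plane} (ht : ‖t‖ = 1) (x : Plane) :
    ‖x‖ ^ 2 = (inner ℝ x t : ℝ) ^ 2 + (inner ℝ x (J t) : ℝ) ^ 2 := by
  have h := norm_sq_plane t
  rw [ht] at h
  simp only [inner_plane, norm_sq_plane, J_apply_zero, J_apply_one]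
  linear_combination (x 0 ^ 2 + x 1 ^ 2) * h

/-! ### Immersed curves -/

section Immersion

variable {γ : ℝ → Plane}

lemma IsH2.isH1 (h : IsH2 γ) : IsH1 γ := by
  obtain ⟨hc, g, k, hg, hk, hug, hgk⟩ := h
  exact ⟨hc, g, hg, hug⟩

lemma IsImmersion.continuousOn_D (h : IsImmersion γ) : ContinuousOn (D γ) I := by
  obtain ⟨k, hk⟩ := h.1.hasDerivWithinAt.2
  exact hk.continuousOn

lemma IsImmersion.continuousOn_speed_inv (h : IsImmersion γ) :
    ContinuousOn (fun x => ‖D γ x‖⁻¹) I :=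
  h.continuousOn_D.norm.inv₀ fun x hx => norm_ne_zero_iff.2 (h.2.1 x hx)

lemma IsImmersion.continuousOn_tangent (h : IsImmersion γ) : ContinuousOn (tangent γ) I :=
  h.continuousOn_speed_inv.smul h.continuousOn_D

lemma IsImmersion.continuousOn_normal (h : IsImmersion γ) : ContinuousOn (normal γ) I :=
  JCLM.continuous.comp_continuousOn h.continuousOn_tangent

lemma IsImmersion.norm_tangent (h : IsImmersion γ) {x : ℝ} (hx : x ∈ I) : ‖tangent γ x‖ = 1 := by
  rw [tangent, arcDeriv, norm_smul, norm_inv, norm_norm,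
    inv_mul_cancel₀ (norm_ne_zero_iff.2 (h.2.1 x hx))]

lemma IsImmersion.speed_smul_tangent (h : IsImmersion γ) {x : ℝ} (hx : x ∈ I) :
    ‖D γ x‖ • tangent γ x = D γ x := by
  rw [tangent, arcDeriv, smul_smul, mul_inv_cancel₀ (norm_ne_zero_iff.2 (h.2.1 x hx)), one_smul]

lemma IsImmersion.length_pos (h : IsImmersion γ) : 0 < length γ :=
  (wirtinger_arcLength h.1.hasDerivWithinAt.1 h.continuousOn_D h.2.1 h.2.2.1).1

lemma _root_.AbsolutelyContinuousOnInterval.comp_lipschitzOnWith {f F : ℝ → ℝ} {a b : ℝ}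
    {K : NNReal} {s : Set ℝ} (hF : LipschitzOnWith K F s)
    (hf : AbsolutelyContinuousOnInterval f a b) (hs : MapsTo f (uIcc a b) s) :
    AbsolutelyContinuousOnInterval (fun x => F (f x)) a b := by
  rw [absolutelyContinuousOnInterval_iff] at hf ⊢
  intro ε hε
  obtain ⟨d, hd, H⟩ := hf (ε / (K + 1)) (by positivity)
  refine ⟨d, hd, fun E hE hE' => ?_⟩
  calc ∑ i ∈ Finset.range E.1, dist (F (f (E.2 i).1)) (F (f (E.2 i).2))
      ≤ ∑ i ∈ Finset.range E.1, ((K : ℝ) + 1) * dist (f (E.2 i).1) (f (E.2 i).2) := by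
        refine Finset.sum_le_sum fun i hi => ?_
        have hi' := hE.1 i (by simpa using hi)
        refine (hF.dist_le_mul _ (hs hi'.1) _ (hs hi'.2)).trans ?_
        exact mul_le_mul_of_nonneg_right (by linarith) dist_nonneg
    _ = ((K : ℝ) + 1) * ∑ i ∈ Finset.range E.1, dist (f (E.2 i).1) (f (E.2 i).2) := by
        rw [Finset.mul_sum]
    _ < ((K : ℝ) + 1) * (ε / (K + 1)) :=
        mul_lt_mul_of_pos_left (H E hE hE') (by positivity)
    _ = ε := by field_simp

/-- The factor |∂ₓγ|⁻¹ is t ↦ 1/√t applied to the absolutely continuous function |∂ₓγ|². By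
compactness the latter has values in an interval away from 0, on which 1/√t is Lipschitz. -/
lemma IsImmersion.absolutelyContinuous_tangent (h : IsImmersion γ) (i : Fin 2) :
    AbsolutelyContinuousOnInterval (fun x => tangent γ x i) 0 (2 * Real.pi) := by
  obtain ⟨k, hk⟩ := h.1.hasDerivWithinAt.2
  have hq : AbsolutelyContinuousOnInterval (fun x => ‖D γ x‖ ^ 2) 0 (2 * Real.pi) := by
    simp_rw [norm_sq_plane, sq]
    exact ((hk.absolutelyContinuous 0).fun_mul (hk.absolutelyContinuous 0)).fun_add
      ((hk.absolutelyContinuous 1).fun_mul (hk.absolutelyContinuous 1))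
  have hne : (Icc 0 (2 * Real.pi)).Nonempty := nonempty_Icc.2 Real.two_pi_pos.le
  obtain ⟨y, hy, hmin⟩ := isCompact_Icc.exists_isMinOn hne h.continuousOn_D.norm
  obtain ⟨z, hz, hmax⟩ := isCompact_Icc.exists_isMaxOn hne h.continuousOn_D.norm
  have hpos : 0 < ‖D γ y‖ := norm_pos_iff.2 (h.2.1 y hy)
  obtain ⟨K, hK⟩ := ContDiffOn.exists_lipschitzOnWith (n := 1) (f := fun t : ℝ => (√t)⁻¹)
    (s := Icc (‖D γ y‖ ^ 2) (‖D γ z‖ ^ 2)) (fun t ht => by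
      have : 0 < t := (by positivity : 0 < ‖D γ y‖ ^ 2).trans_le ht.1
      exact ((Real.contDiffAt_sqrt this.ne').inv (Real.sqrt_pos.2 this).ne').contDiffWithinAt)
    one_ne_zero (convex_Icc _ _) isCompact_Icc
  have hmaps : MapsTo (fun x => ‖D γ x‖ ^ 2) (uIcc 0 (2 * Real.pi))
      (Icc (‖D γ y‖ ^ 2) (‖D γ z‖ ^ 2)) := by
    intro x hx
    rw [uIcc_of_le Real.two_pi_pos.le] at hx
    exact ⟨pow_le_pow_left₀ (norm_nonneg _) (hmin hx) 2,
      pow_le_pow_left₀ (norm_nonneg _) (hmax hx) 2⟩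
  refine ((AbsolutelyContinuousOnInterval.comp_lipschitzOnWith hK hq hmaps).fun_mul
    (hk.absolutelyContinuous i)).congr fun x _ => ?_
  simp only [tangent, arcDeriv, PiLp.smul_apply, smul_eq_mul]
  rw [Real.sqrt_sq (norm_nonneg _)]

/-- The Frenet equation `∂ₓ τ = κ |∂ₓ γ| ν`, at points where `∂ₓ γ` is differentiable. -/
lemma IsImmersion.hasDerivAt_tangent_of_hasDerivAt (h : IsImmersion γ) {x : ℝ} {k : Plane}
    (hx : x ∈ Ioo 0 (2 * Real.pi)) (hk : HasDerivAt (D γ) k x) :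
    HasDerivAt (tangent γ) ((curvature γ x * ‖D γ x‖) • normal γ x) x ∧
      curvature γ x = (‖D γ x‖⁻¹) ^ 2 * inner ℝ k (normal γ x) := by
  have hxI : x ∈ I := Ioo_subset_Icc_self hx
  have hne := h.2.1 x hxI
  have hv : ‖D γ x‖ ≠ 0 := norm_ne_zero_iff.2 hne
  have hinv : DifferentiableAt ℝ (fun y => ‖D γ y‖⁻¹) x :=
    (hk.differentiableAt.norm ℝ hne).inv hv
  have ht := hinv.hasDerivAt.smul hk
  set a := deriv (fun y => ‖D γ y‖⁻¹) x
  set t' : Plane := ‖D γ x‖⁻¹ • k + a • D γ x with ht'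
  have htan : HasDerivAt (tangent γ) t' x := ht
  have hDt : D (tangent γ) x = t' := D_eq_of_hasDerivAt hxI htan
  have hνw : inner ℝ (D γ x) (normal γ x) = 0 := by
    rw [← h.speed_smul_tangent hxI, inner_smul_left, normal, inner_J_self, mul_zero]
  have hcurv : curvature γ x = ‖D γ x‖⁻¹ * inner ℝ t' (normal γ x) := by
    rw [curvature, arcDeriv, hDt, inner_smul_left]
    rfl
  have horth : inner ℝ t' (tangent γ x) = 0 := by
    have h1 := htan.inner ℝ htan
    have h2 : HasDerivAt (fun y => (inner ℝ (tangent γ y) (tangent γ y) : ℝ)) 0 x := by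
      refine (hasDerivAt_const x (1 : ℝ)).congr_of_eventuallyEq ?_
      filter_upwards [I_mem_nhds hx] with y hy
      rw [real_inner_self_eq_norm_sq, h.norm_tangent hy, one_pow]
    have h3 := h1.unique h2
    rw [real_inner_comm] at h3
    linarith
  refine ⟨?_, ?_⟩
  · convert htan using 1
    have h4 := eq_inner_smul_add_inner_smul_J (h.norm_tangent hxI) t'
    rw [horth, zero_smul, zero_add] at h4
    rw [h4, hcurv, normal]
    congr 1
    rw [← normal]
    field_simp
  · rw [hcurv, ht', inner_add_left, inner_smul_left, inner_smul_left, hνw]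
    simp
    ring

lemma IsImmersion.ae_hasDerivAt_tangent (h : IsImmersion γ) :
    ∀ᵐ x, x ∈ Ioo 0 (2 * Real.pi) →
      HasDerivAt (tangent γ) ((curvature γ x * ‖D γ x‖) • normal γ x) x := by
  obtain ⟨k, hk⟩ := h.1.hasDerivWithinAt.2
  filter_upwards [hk.ae_hasDerivAt] with x hx hxI
  exact (h.hasDerivAt_tangent_of_hasDerivAt hxI (hx hxI)).1

lemma hasDerivAt_normal {x c : ℝ} (h : HasDerivAt (tangent γ) (c • normal γ x) x) :
    HasDerivAt (normal γ) (-c • tangent γ x) x := by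
  have := JCLM.hasFDerivAt.comp_hasDerivAt x h
  rw [map_smul, JCLM_apply, normal, J_J, smul_neg, ← neg_smul] at this
  exact this

lemma IsImmersion.hasDerivAt (h : IsImmersion γ) {x : ℝ} (hx : x ∈ Ioo 0 (2 * Real.pi)) :
    HasDerivAt γ (D γ x) x :=
  (h.1.hasDerivWithinAt.1 x (Ioo_subset_Icc_self hx)).hasDerivAt (I_mem_nhds hx)

/-! ### Square integrability -/

lemma MemLp.mul_continuousOn {f g : ℝ → ℝ}
    (hf : MemLp f 2 (volume.restrict (Ioo 0 (2 * Real.pi)))) (hg : ContinuousOn g I) :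
    MemLp (fun x => f x * g x) 2 (volume.restrict (Ioo 0 (2 * Real.pi))) :=
  (memLp_of_continuousOn hg ⊤).mul hf

lemma InL2.inner_continuousOn {g u : ℝ → Plane} (hg : InL2 g) (hu : ContinuousOn u I) :
    MemLp (fun x => (inner ℝ (g x) (u x) : ℝ)) 2 (volume.restrict (Ioo 0 (2 * Real.pi))) := by
  have hc : ∀ i : Fin 2, ContinuousOn (fun x => u x i) I := fun i =>
    (EuclideanSpace.proj i : Plane →L[ℝ] ℝ).continuous.comp_continuousOn hu
  have hg' : ∀ i : Fin 2, MemLp (fun x => g x i) 2 (volume.restrict (Ioo 0 (2 * Real.pi))) :=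
    fun i => (EuclideanSpace.proj i : Plane →L[ℝ] ℝ).comp_memLp' hg
  simp_rw [inner_plane]
  exact (MemLp.mul_continuousOn (hg' 0) (hc 0)).add (MemLp.mul_continuousOn (hg' 1) (hc 1))

lemma intervalIntegrable_mul_of_memLp {f g : ℝ → ℝ}
    (hf : MemLp f 2 (volume.restrict (Ioo 0 (2 * Real.pi))))
    (hg : MemLp g 2 (volume.restrict (Ioo 0 (2 * Real.pi)))) :
    IntervalIntegrable (fun x => f x * g x) volume 0 (2 * Real.pi) := by
  rw [intervalIntegrable_iff_integrableOn_Ioo_of_le Real.two_pi_pos.le]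
  exact hf.integrable_mul hg

/-- The classical derivative inside κ is controlled only almost everywhere. There κ = |∂ₓγ|⁻²⟨∂ₓ²γ,
ν⟩, an L² function paired with continuous factors. -/
lemma IsImmersion.memLp_curvature (h : IsImmersion γ) :
    MemLp (curvature γ) 2 (volume.restrict (Ioo 0 (2 * Real.pi))) := by
  obtain ⟨k, hk⟩ := h.1.hasDerivWithinAt.2
  have h1 := MemLp.mul_continuousOn (hk.inL2.inner_continuousOn h.continuousOn_normal)
    (h.continuousOn_speed_inv.pow 2)
  refine h1.ae_eq ((ae_restrict_iff' measurableSet_Ioo).2 ?_)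
  filter_upwards [hk.ae_hasDerivAt] with x hx hxI
  rw [(h.hasDerivAt_tangent_of_hasDerivAt hxI (hx hxI)).2, mul_comm]
  rfl

lemma IsImmersion.memLp_arcDeriv (h : IsImmersion γ) {η u : ℝ → Plane} (hη : IsH1 η)
    (hu : ContinuousOn u I) :
    MemLp (fun x => (inner ℝ (arcDeriv γ η x) (u x) : ℝ)) 2
      (volume.restrict (Ioo 0 (2 * Real.pi))) := by
  obtain ⟨g, hg⟩ := hη.exists_isPrimitive
  have h1 := MemLp.mul_continuousOn (hg.inL2.inner_continuousOn hu) h.continuousOn_speed_inv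
  refine h1.ae_eq ((ae_restrict_iff' measurableSet_Ioo).2 ?_)
  filter_upwards [hg.ae_hasDerivAt] with x hx hxI
  rw [arcDeriv, D_eq_of_hasDerivAt (Ioo_subset_Icc_self hxI) (hx hxI), inner_smul_left, mul_comm]
  rfl

/-- Integration by parts: `∫ κ ⟨γ - p, ν⟩ ds = -L`. -/
lemma IsImmersion.integral_curvature_mul_inner (h : IsImmersion γ) (p : Plane) :
    ∫ x in (0 : ℝ)..(2 * Real.pi),
      curvature γ x * inner ℝ (γ x - p) (normal γ x) * ‖D γ x‖ = -length γ := by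
  obtain ⟨g, hg⟩ := h.1.isH1.exists_isPrimitive
  have hconst : ∀ c : ℝ, AbsolutelyContinuousOnInterval (fun _ : ℝ => c) 0 (2 * Real.pi) :=
    fun c => (LipschitzWith.const c).lipschitzOnWith.absolutelyContinuousOnInterval
  -- The derivative of ⟨γ-p, τ⟩ is |∂ₓγ| + κ⟨γ-p, ν⟩|∂ₓγ| almost everywhere, and its integral
  -- vanishes because γ and τ close up.
  have hAC : AbsolutelyContinuousOnInterval
      (fun x => (inner ℝ (γ x - p) (tangent γ x) : ℝ)) 0 (2 * Real.pi) := by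
    simp_rw [inner_plane, PiLp.sub_apply]
    exact (((hg.absolutelyContinuous 0).fun_sub (hconst _)).fun_mul
      (h.absolutelyContinuous_tangent 0)).fun_add
      (((hg.absolutelyContinuous 1).fun_sub (hconst _)).fun_mul (h.absolutelyContinuous_tangent 1))
  have h1 := hAC.integral_deriv_eq_sub
  have hend : (inner ℝ (γ (2 * Real.pi) - p) (tangent γ (2 * Real.pi)) : ℝ) =
      inner ℝ (γ 0 - p) (tangent γ 0) := by
    simp only [tangent, arcDeriv]
    rw [h.2.2.1, h.2.2.2]
  have hcN : ContinuousOn (fun x => (inner ℝ (γ x - p) (normal γ x) : ℝ) * ‖D γ x‖) I :=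
    ((h.1.1.sub continuousOn_const).inner h.continuousOn_normal).mul h.continuousOn_D.norm
  have hint : IntervalIntegrable
      (fun x => curvature γ x * inner ℝ (γ x - p) (normal γ x) * ‖D γ x‖) volume 0
      (2 * Real.pi) := by
    simp_rw [mul_assoc]
    exact intervalIntegrable_mul_of_memLp h.memLp_curvature (memLp_of_continuousOn hcN 2)
  have hintv : IntervalIntegrable (fun x => ‖D γ x‖) volume 0 (2 * Real.pi) :=
    ContinuousOn.intervalIntegrable (by
      rw [uIcc_of_le Real.two_pi_pos.le]; exact h.continuousOn_D.norm)
  rw [hend, sub_self, intervalIntegral.integral_congr_ae (g := fun x =>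
    curvature γ x * inner ℝ (γ x - p) (normal γ x) * ‖D γ x‖ + ‖D γ x‖),
    intervalIntegral.integral_add hint hintv] at h1
  · rw [length_eq_arcLength, arcLength]
    linarith
  have hne : ∀ᵐ t : ℝ, t ≠ 2 * Real.pi := by simp [ae_iff]
  filter_upwards [h.ae_hasDerivAt_tangent, hne] with x hx hne hxI
  rw [uIoc_of_le Real.two_pi_pos.le] at hxI
  have hxI' : x ∈ Ioo 0 (2 * Real.pi) := ⟨hxI.1, lt_of_le_of_ne hxI.2 hne⟩
  have h2 := ((h.hasDerivAt hxI').sub_const p).inner ℝ (hx hxI')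
  rw [h2.deriv, inner_smul_right]
  have hxI'' : x ∈ I := Ioo_subset_Icc_self hxI'
  have h3 : (inner ℝ (D γ x) (tangent γ x) : ℝ) = ‖D γ x‖ := by
    conv_lhs => rw [← h.speed_smul_tangent hxI'', inner_smul_left, real_inner_self_eq_norm_sq,
      h.norm_tangent hxI'']
    simp
  rw [h3]
  ring

end Immersion

/-! ### The energy as a sum of squares -/

section Energy

variable {γ : ℝ → Plane}

lemma IsImmersion.intervalIntegrable_mul (h : IsImmersion γ) {f g : ℝ → ℝ}
    (hf : MemLp f 2 (volume.restrict (Ioo 0 (2 * Real.pi))))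
    (hg : MemLp g 2 (volume.restrict (Ioo 0 (2 * Real.pi)))) :
    IntervalIntegrable (fun x => f x * g x * ‖D γ x‖) volume 0 (2 * Real.pi) := by
  simp_rw [mul_assoc]
  exact intervalIntegrable_mul_of_memLp hf (MemLp.mul_continuousOn hg h.continuousOn_D.norm)

lemma IsImmersion.intervalIntegrable_sq (h : IsImmersion γ) {f : ℝ → ℝ}
    (hf : MemLp f 2 (volume.restrict (Ioo 0 (2 * Real.pi)))) :
    IntervalIntegrable (fun x => f x ^ 2 * ‖D γ x‖) volume 0 (2 * Real.pi) := by
  simp_rw [sq]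
  exact h.intervalIntegrable_mul hf hf

lemma lineIntegral_congr {f g : ℝ → ℝ} (h : ∀ x ∈ I, f x = g x) :
    lineIntegral γ f = lineIntegral γ g := by
  refine intervalIntegral.integral_congr fun x hx => ?_
  rw [uIcc_of_le Real.two_pi_pos.le] at hx
  show f x * _ = g x * _
  rw [h x hx]

lemma lineIntegral_nonneg {f : ℝ → ℝ} (h : ∀ x ∈ I, 0 ≤ f x) : 0 ≤ lineIntegral γ f :=
  intervalIntegral.integral_nonneg Real.two_pi_pos.le fun x hx =>
    mul_nonneg (h x hx) (norm_nonneg _)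

lemma lineIntegral_comb {f g : ℝ → ℝ} (a b : ℝ)
    (hf : IntervalIntegrable (fun x => f x * ‖D γ x‖) volume 0 (2 * Real.pi))
    (hg : IntervalIntegrable (fun x => g x * ‖D γ x‖) volume 0 (2 * Real.pi)) :
    lineIntegral γ (fun x => a * f x + b * g x) = a * lineIntegral γ f + b * lineIntegral γ g := by
  simp only [lineIntegral]
  rw [← intervalIntegral.integral_const_mul, ← intervalIntegral.integral_const_mul,
    ← intervalIntegral.integral_add (hf.const_mul a) (hg.const_mul b)]
  congr 1
  ext x
  ring

lemma IntervalIntegrable.comb {f g : ℝ → ℝ} (a b : ℝ)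
    (hf : IntervalIntegrable (fun x => f x * ‖D γ x‖) volume 0 (2 * Real.pi))
    (hg : IntervalIntegrable (fun x => g x * ‖D γ x‖) volume 0 (2 * Real.pi)) :
    IntervalIntegrable (fun x => (a * f x + b * g x) * ‖D γ x‖) volume 0 (2 * Real.pi) := by
  convert (hf.const_mul a).add (hg.const_mul b) using 1
  ext x
  ring

/-- The component of `∂ₛ η` normal to `γ`. -/
def normalPart (γ η : ℝ → Plane) (x : ℝ) : ℝ := inner ℝ (arcDeriv γ η x) (normal γ x)

/-- The matrix v ⊗ τ with |τ| = 1 has norm |v|, and |v|² splits along the frame τ, ν. -/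
lemma IsImmersion.sum_gradient_sq (h : IsImmersion γ) (η : ℝ → Plane) {x : ℝ} (hx : x ∈ I) :
    ∑ i, ∑ j, gradient γ η x i j ^ 2 = divergence γ η x ^ 2 + normalPart γ η x ^ 2 := by
  have h1 := norm_sq_eq_inner_sq_add_inner_J_sq (h.norm_tangent hx) (arcDeriv γ η x)
  have h2 := norm_sq_plane (tangent γ x)
  rw [h.norm_tangent hx] at h2
  rw [norm_sq_plane] at h1
  simp only [divergence, normalPart, normal, gradient]
  rw [← h1]
  simp only [Fin.sum_univ_two, Matrix.of_apply]
  linear_combination -(arcDeriv γ η x 0 ^ 2 + arcDeriv γ η x 1 ^ 2) * h2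

/-- The energy after completing the square in the divergence. -/
lemma IsImmersion.energy_eq (h : IsImmersion γ) {η : ℝ → Plane} (hη : IsH1 η) {lam : ℝ} (δ : ℝ)
    (hlam : 0 < lam) :
    energy lam δ γ η = (lam + δ ^ 2) / 2 *
        lineIntegral γ (fun x => (divergence γ η x + δ / (lam + δ ^ 2) * curvature γ x) ^ 2) +
      lam / 2 * lineIntegral γ (fun x => normalPart γ η x ^ 2) +
      lam / (2 * (lam + δ ^ 2)) * lineIntegral γ (fun x => curvature γ x ^ 2) + length γ := by
  have hpos : 0 < lam + δ ^ 2 := by positivity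
  have hκ := h.memLp_curvature
  have hd : MemLp (divergence γ η) 2 (volume.restrict (Ioo 0 (2 * Real.pi))) :=
    h.memLp_arcDeriv hη h.continuousOn_tangent
  have he : MemLp (normalPart γ η) 2 (volume.restrict (Ioo 0 (2 * Real.pi))) :=
    h.memLp_arcDeriv hη h.continuousOn_normal
  have hA := h.intervalIntegrable_sq (hκ.add (hd.const_mul δ))
  have hP := h.intervalIntegrable_sq (hd.add (hκ.const_mul (δ / (lam + δ ^ 2))))
  have hD := h.intervalIntegrable_sq hd
  have hE := h.intervalIntegrable_sq he
  have hK := h.intervalIntegrable_sq hκ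
  have hB := IntervalIntegrable.comb 1 1 hD hE
  simp only [Pi.add_apply] at hA hP
  have h1 := lineIntegral_comb (1 / 2) (lam / 2) hA hB
  have h2 := lineIntegral_comb ((lam + δ ^ 2) / 2) (lam / 2) hP hE
  have h3 := lineIntegral_comb 1 (lam / (2 * (lam + δ ^ 2)))
    (IntervalIntegrable.comb ((lam + δ ^ 2) / 2) (lam / 2) hP hE) hK
  have h3' := h3
  rw [one_mul (lineIntegral γ _)] at h3'
  have hg : lineIntegral γ (fun x => ∑ i, ∑ j, gradient γ η x i j ^ 2) =
      lineIntegral γ (fun x => 1 * divergence γ η x ^ 2 + 1 * normalPart γ η x ^ 2) :=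
    lineIntegral_congr fun x hx => by rw [h.sum_gradient_sq η hx, one_mul, one_mul]
  rw [energy, hg, ← h1, ← h2, ← h3']
  congr 1
  refine lineIntegral_congr fun x _ => ?_
  field_simp
  ring

/-- Expand the square; the mixed term is known from ∫κ⟨γ-p, ν⟩ ds = -L. The comparison function is
suggested by the circle of radius 1/q about p, where κ = -q²⟨γ-p, ν⟩. -/
lemma IsImmersion.lineIntegral_curvature_sq (h : IsImmersion γ) (p : Plane) (q : ℝ) :
    lineIntegral γ (fun x => curvature γ x ^ 2) =
      lineIntegral γ (fun x => (curvature γ x + q ^ 2 * inner ℝ (γ x - p) (normal γ x)) ^ 2) +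
      2 * q ^ 2 * length γ -
      q ^ 4 * lineIntegral γ (fun x => (inner ℝ (γ x - p) (normal γ x) : ℝ) ^ 2) := by
  have hκ := h.memLp_curvature
  have hN : MemLp (fun x => (inner ℝ (γ x - p) (normal γ x) : ℝ)) 2
      (volume.restrict (Ioo 0 (2 * Real.pi))) :=
    memLp_of_continuousOn ((h.1.1.sub continuousOn_const).inner h.continuousOn_normal) 2
  have hK := h.intervalIntegrable_sq hκ
  have hM := h.intervalIntegrable_mul hκ hN
  have h1 := lineIntegral_comb 1 (2 * q ^ 2) hK hM
  have h2 := lineIntegral_comb 1 (q ^ 4) (IntervalIntegrable.comb 1 (2 * q ^ 2) hK hM)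
    (h.intervalIntegrable_sq hN)
  rw [h1] at h2
  have h3 : lineIntegral γ (fun x => curvature γ x * inner ℝ (γ x - p) (normal γ x)) =
      -length γ := h.integral_curvature_mul_inner p
  rw [h3] at h2
  rw [lineIntegral_congr (g := fun x => 1 * (1 * curvature γ x ^ 2 + 2 * q ^ 2 *
    (curvature γ x * inner ℝ (γ x - p) (normal γ x))) +
    q ^ 4 * (inner ℝ (γ x - p) (normal γ x) : ℝ) ^ 2)
    (f := fun x => (curvature γ x + q ^ 2 * inner ℝ (γ x - p) (normal γ x)) ^ 2)
    (fun x _ => by ring), h2]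
  ring

lemma IsImmersion.lineIntegral_inner_normal_le (h : IsImmersion γ) (p : Plane) :
    lineIntegral γ (fun x => (inner ℝ (γ x - p) (normal γ x) : ℝ) ^ 2) ≤
      ∫ x in (0 : ℝ)..(2 * Real.pi), ‖γ x - p‖ ^ 2 * ‖D γ x‖ := by
  have hc : ContinuousOn (fun x => γ x - p) I := h.1.1.sub continuousOn_const
  refine intervalIntegral.integral_mono_on Real.two_pi_pos.le ?_ ?_ fun x hx => ?_
  · exact ContinuousOn.intervalIntegrable (by
      rw [uIcc_of_le Real.two_pi_pos.le]
      exact ((hc.inner h.continuousOn_normal).pow 2).mul h.continuousOn_D.norm)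
  · exact ContinuousOn.intervalIntegrable (by
      rw [uIcc_of_le Real.two_pi_pos.le]
      exact (hc.norm.pow 2).mul h.continuousOn_D.norm)
  · refine mul_le_mul_of_nonneg_right ?_ (norm_nonneg _)
    rw [norm_sq_eq_inner_sq_add_inner_J_sq (h.norm_tangent hx) (γ x - p)]
    exact le_add_of_nonneg_left (sq_nonneg _)

/-- The radius of the optimal circles. -/
def optRadius (lam δ : ℝ) : ℝ := √lam / √(2 * (lam + δ ^ 2))

lemma optRadius_pos {lam : ℝ} (δ : ℝ) (hlam : 0 < lam) : 0 < optRadius lam δ := by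
  unfold optRadius; positivity

lemma optRadius_sq {lam : ℝ} (δ : ℝ) (hlam : 0 < lam) :
    optRadius lam δ ^ 2 = lam / (2 * (lam + δ ^ 2)) := by
  rw [optRadius, div_pow, Real.sq_sqrt hlam.le, Real.sq_sqrt (by positivity)]

/-- 4πR is the minimum of 4π²R²/L + L over L > 0, attained at L = 2πR; in this form the bound can be
compared with the energy. -/
lemma lowerBound_eq {lam : ℝ} (δ : ℝ) (hlam : 0 < lam) :
    lowerBound lam δ = 4 * Real.pi * optRadius lam δ := by
  have h1 : 2 * lam / (lam + δ ^ 2) = (2 * optRadius lam δ) ^ 2 := by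
    rw [mul_pow, optRadius_sq δ hlam]
    have : lam + δ ^ 2 ≠ 0 := by positivity
    field_simp
  rw [lowerBound, h1, Real.sqrt_sq (by have := optRadius_pos δ hlam; positivity)]
  ring

/-- The lower bound for the energy, with what can be said about the minimizers at once. -/
lemma IsImmersion.lowerBound_le_energy (h : IsImmersion γ) {η : ℝ → Plane} (hη : IsH1 η)
    {lam : ℝ} (δ : ℝ) (hlam : 0 < lam) :
    lowerBound lam δ ≤ energy lam δ γ η ∧ (energy lam δ γ η = lowerBound lam δ →
      lineIntegral γ
        (fun x => (divergence γ η x + δ / (lam + δ ^ 2) * curvature γ x) ^ 2) = 0 ∧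
      lineIntegral γ (fun x => normalPart γ η x ^ 2) = 0 ∧
      length γ = 2 * Real.pi * optRadius lam δ ∧
      ∃ p a b : Plane, ∀ x ∈ I, γ x = p + Real.cos (arcLength γ x / optRadius lam δ) • a +
        Real.sin (arcLength γ x / optRadius lam δ) • b) := by
  obtain ⟨hL, p, hW, hWeq⟩ :=
    wirtinger_arcLength h.1.hasDerivWithinAt.1 h.continuousOn_D h.2.1 h.2.2.1
  have hE := h.energy_eq hη δ hlam
  have hR := optRadius_pos δ hlam
  have hN := h.lineIntegral_inner_normal_le p
  have hK := h.lineIntegral_curvature_sq p (2 * Real.pi / length γ)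
  rw [← optRadius_sq δ hlam] at hE
  rw [lowerBound_eq δ hlam]
  set P := lineIntegral γ
    (fun x => (divergence γ η x + δ / (lam + δ ^ 2) * curvature γ x) ^ 2)
  set Q := lineIntegral γ (fun x => normalPart γ η x ^ 2)
  set C := lineIntegral γ (fun x => (curvature γ x + (2 * Real.pi / length γ) ^ 2 *
    inner ℝ (γ x - p) (normal γ x)) ^ 2)
  set N := lineIntegral γ (fun x => (inner ℝ (γ x - p) (normal γ x) : ℝ) ^ 2)
  set M := ∫ x in (0 : ℝ)..(2 * Real.pi), ‖γ x - p‖ ^ 2 * ‖D γ x‖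
  set q := 2 * Real.pi / length γ with hq
  set R := optRadius lam δ
  have hP0 : 0 ≤ P := lineIntegral_nonneg fun x _ => sq_nonneg _
  have hQ0 : 0 ≤ Q := lineIntegral_nonneg fun x _ => sq_nonneg _
  have hC0 : 0 ≤ C := lineIntegral_nonneg fun x _ => sq_nonneg _
  have hqpos : 0 < q := div_pos Real.two_pi_pos hL
  have hqL : q * length γ = 2 * Real.pi := div_mul_cancel₀ _ hL.ne'
  have hNM : q ^ 2 * N ≤ q ^ 2 * M := mul_le_mul_of_nonneg_left hN (sq_nonneg _)
  -- The terms are, in turn, the two squares in ∂ₛη, the curvature square, the Wirtinger deficit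
  -- (enlarged by passing from |γ-p|² to its normal part) and the deficit in the
  -- arithmetic-geometric mean inequality.
  have hdef : energy lam δ γ η - 4 * Real.pi * R = (lam + δ ^ 2) / 2 * P + lam / 2 * Q +
      R ^ 2 * C + R ^ 2 * q ^ 2 * (length γ - q ^ 2 * N) + length γ * (q * R - 1) ^ 2 := by
    rw [hE, hK]
    linear_combination (2 * R) * hqL
  have hc1 : 0 < (lam + δ ^ 2) / 2 := by positivity
  have hc2 : 0 < lam / 2 := by positivity
  have hc3 : 0 < R ^ 2 * q ^ 2 := by positivity
  have t1 : 0 ≤ (lam + δ ^ 2) / 2 * P := mul_nonneg hc1.le hP0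
  have t2 : 0 ≤ lam / 2 * Q := mul_nonneg hc2.le hQ0
  have t3 : 0 ≤ R ^ 2 * C := mul_nonneg (sq_nonneg _) hC0
  have t4 : 0 ≤ R ^ 2 * q ^ 2 * (length γ - q ^ 2 * N) := mul_nonneg hc3.le (by linarith)
  have t5 : 0 ≤ length γ * (q * R - 1) ^ 2 := mul_nonneg hL.le (sq_nonneg _)
  refine ⟨by linarith, fun heq => ?_⟩
  have s1 : (lam + δ ^ 2) / 2 * P = 0 := by linarith
  have s2 : lam / 2 * Q = 0 := by linarith
  have s4 : R ^ 2 * q ^ 2 * (length γ - q ^ 2 * N) = 0 := by linarith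
  have s5 : length γ * (q * R - 1) ^ 2 = 0 := by linarith
  have hqR : q * R = 1 := by
    have := pow_eq_zero_iff (two_ne_zero) |>.1 ((mul_eq_zero.1 s5).resolve_left hL.ne')
    linarith
  have hqN := (mul_eq_zero.1 s4).resolve_left hc3.ne'
  refine ⟨(mul_eq_zero.1 s1).resolve_left hc1.ne', (mul_eq_zero.1 s2).resolve_left hc2.ne', ?_,
    p, ?_⟩
  · rw [← hqL]
    linear_combination (-length γ) * hqR
  -- Now L = q²N ≤ q²M ≤ L, so Wirtinger's inequality is an equality.
  · obtain ⟨a, b, hab⟩ := hWeq (by linarith)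
    refine ⟨a, b, fun x hx => ?_⟩
    rw [hab x hx]
    have : arcLength γ x / R = q * arcLength γ x := by
      rw [div_eq_iff hR.ne']
      linear_combination (-arcLength γ x) * hqR
    rw [this]

end Energy

/-! ### Circles -/

/-- The point of the unit circle with polar angle `θ`. -/
def unitVec (θ : ℝ) : Plane := !₂[Real.cos θ, Real.sin θ]

@[simp] lemma unitVec_apply_zero (θ : ℝ) : unitVec θ 0 = Real.cos θ := rfl

@[simp] lemma unitVec_apply_one (θ : ℝ) : unitVec θ 1 = Real.sin θ := rfl

lemma norm_unitVec (θ : ℝ) : ‖unitVec θ‖ = 1 := by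
  rw [← sq_eq_sq₀ (norm_nonneg _) zero_le_one, norm_sq_plane]
  simp

lemma norm_J_unitVec (θ : ℝ) : ‖J (unitVec θ)‖ = 1 := by rw [norm_J, norm_unitVec]

lemma hasDerivAt_unitVec (θ : ℝ) : HasDerivAt unitVec (J (unitVec θ)) θ := by
  have h1 := ((Real.hasDerivAt_cos θ).smul_const (!₂[1, 0] : Plane)).add
    ((Real.hasDerivAt_sin θ).smul_const (!₂[0, 1] : Plane))
  convert! h1 using 1
  · ext t i
    fin_cases i <;> simp [unitVec]
  · apply plane_ext <;> simp

lemma continuous_unitVec : Continuous unitVec :=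
  continuous_iff_continuousAt.2 fun θ => (hasDerivAt_unitVec θ).continuousAt

lemma unitVec_add (θ t : ℝ) :
    unitVec (θ + t) = Real.cos t • unitVec θ + Real.sin t • J (unitVec θ) := by
  apply plane_ext
  · simp [Real.cos_add]; ring
  · simp [Real.sin_add]; ring

lemma rot_unitVec (φ θ : ℝ) : rot φ (unitVec θ) = unitVec (φ + θ) := by
  apply plane_ext
  · simp [rot, Real.cos_add]
  · simp [rot, Real.sin_add]

lemma rot_smul (φ c : ℝ) (v : Plane) : rot φ (c • v) = c • rot φ v := by
  apply plane_ext
  · simp [rot]; ring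
  · simp [rot]; ring

lemma exists_eq_smul_unitVec {z : Plane} {R : ℝ} (hz : ‖z‖ = R) : ∃ θ, z = R • unitVec θ := by
  have h := norm_sq_plane z
  rw [hz] at h
  refine ⟨Complex.arg ⟨z 0, z 1⟩, ?_⟩
  have hR : ‖(⟨z 0, z 1⟩ : ℂ)‖ = R := by
    rw [← sq_eq_sq₀ (norm_nonneg _) (hz ▸ norm_nonneg _), h, Complex.sq_norm,
      Complex.normSq_mk]
    ring
  apply plane_ext
  · have := Complex.norm_mul_cos_arg ⟨z 0, z 1⟩
    rw [hR] at this
    simpa using this.symm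
  · have := Complex.norm_mul_sin_arg ⟨z 0, z 1⟩
    rw [hR] at this
    simpa using this.symm

lemma cos_sub_eq_one_of_unitVec_eq {a b : ℝ} (h : unitVec a = unitVec b) :
    Real.cos (a - b) = 1 := by
  have h0 : Real.cos a = Real.cos b := congrArg (fun v : Plane => v 0) h
  have h1 : Real.sin a = Real.sin b := congrArg (fun v : Plane => v 1) h
  rw [Real.cos_sub, h0, h1]
  linarith [Real.sin_sq_add_cos_sq b, sq (Real.sin b), sq (Real.cos b)]

/-! ### The arc length function -/

section ArcLength

variable {γ : ℝ → Plane}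

lemma zero_mem_I : (0 : ℝ) ∈ I := ⟨le_rfl, Real.two_pi_pos.le⟩

lemma two_pi_mem_I : 2 * Real.pi ∈ I := ⟨Real.two_pi_pos.le, le_rfl⟩

lemma arcLength_zero : arcLength γ 0 = 0 := by simp [arcLength]

lemma IsImmersion.hasDerivWithinAt_arcLength (h : IsImmersion γ) {x : ℝ} (hx : x ∈ I) :
    HasDerivWithinAt (arcLength γ) ‖D γ x‖ I x := by
  have hc := h.continuousOn_D.norm
  have : Fact (x ∈ Icc 0 (2 * Real.pi)) := ⟨hx⟩
  exact intervalIntegral.integral_hasDerivWithinAt_right (s := Icc 0 (2 * Real.pi))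
    (t := Icc 0 (2 * Real.pi)) (hc.mono (by
      rw [uIcc_of_le hx.1]; exact Icc_subset_Icc le_rfl hx.2)).intervalIntegrable
    (hc.stronglyMeasurableAtFilter_nhdsWithin measurableSet_Icc x) (hc x hx)

lemma IsImmersion.continuousOn_arcLength (h : IsImmersion γ) : ContinuousOn (arcLength γ) I :=
  fun _ hx => (h.hasDerivWithinAt_arcLength hx).continuousWithinAt

lemma IsImmersion.strictMonoOn_arcLength (h : IsImmersion γ) : StrictMonoOn (arcLength γ) I := by
  refine strictMonoOn_of_deriv_pos (convex_Icc _ _) h.continuousOn_arcLength fun x hx => ?_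
  rw [interior_Icc] at hx
  have hxI : x ∈ I := Ioo_subset_Icc_self hx
  rw [((h.hasDerivWithinAt_arcLength hxI).hasDerivAt (I_mem_nhds hx)).deriv]
  exact norm_pos_iff.2 (h.2.1 x hxI)

lemma IsImmersion.exists_arcLength_eq (h : IsImmersion γ) {t : ℝ} (ht : t ∈ Icc 0 (length γ)) :
    ∃ x ∈ I, arcLength γ x = t := by
  rw [length_eq_arcLength] at ht
  exact intermediate_value_Icc Real.two_pi_pos.le h.continuousOn_arcLength
    (by rwa [arcLength_zero])

/-- The curve `γ` runs once through the circle of radius `R` about `p`, with orientation `ε`,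
starting at polar angle `θ`. -/
structure IsCircleParam (γ : ℝ → Plane) (R : ℝ) (p : Plane) (θ ε : ℝ) : Prop where
  sign : ε = 1 ∨ ε = -1
  length_eq : length γ = 2 * Real.pi * R
  eq : ∀ x ∈ I, γ x = p + R • unitVec (θ + ε * (arcLength γ x / R))

variable {R θ ε : ℝ} {p : Plane}

lemma IsCircleParam.sq (hc : IsCircleParam γ R p θ ε) : ε * ε = 1 := by
  rcases hc.sign with h | h <;> rw [h] <;> norm_num

lemma IsImmersion.D_of_isCircleParam (h : IsImmersion γ) (hR : 0 < R)
    (hc : IsCircleParam γ R p θ ε) {x : ℝ} (hx : x ∈ I) :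
    D γ x = (ε * ‖D γ x‖) • J (unitVec (θ + ε * (arcLength γ x / R))) := by
  have h1 : HasDerivWithinAt (fun x => θ + ε * (arcLength γ x / R)) (ε * (‖D γ x‖ / R)) I x :=
    (((h.hasDerivWithinAt_arcLength hx).div_const R).const_mul ε).const_add θ
  have h2 := ((((hasDerivAt_unitVec _).scomp_hasDerivWithinAt x h1).const_smul R).const_add
    p).congr hc.eq (hc.eq x hx)
  have h3 := h2.derivWithin (uniqueDiffOn_I x hx)
  change D γ x = _ at h3
  conv_lhs => rw [h3, smul_smul]
  congr 1
  field_simp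

lemma IsImmersion.normal_of_isCircleParam (h : IsImmersion γ) (hR : 0 < R)
    (hc : IsCircleParam γ R p θ ε) {x : ℝ} (hx : x ∈ I) :
    normal γ x = -ε • unitVec (θ + ε * (arcLength γ x / R)) := by
  have hv : ‖D γ x‖ ≠ 0 := norm_ne_zero_iff.2 (h.2.1 x hx)
  have h1 := h.D_of_isCircleParam hR hc hx
  have h2 : tangent γ x = ε • J (unitVec (θ + ε * (arcLength γ x / R))) := by
    rw [tangent, arcDeriv]
    nth_rewrite 2 [h1]
    rw [smul_smul]
    congr 1
    field_simp
  rw [normal, h2, ← JCLM_apply, map_smul, JCLM_apply, J_J, smul_neg, neg_smul]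

lemma IsImmersion.normal_eq_smul_sub_of_isCircleParam (h : IsImmersion γ) (hR : 0 < R)
    (hc : IsCircleParam γ R p θ ε) {x : ℝ} (hx : x ∈ I) :
    normal γ x = (-(ε / R)) • (γ x - p) := by
  rw [h.normal_of_isCircleParam hR hc hx, hc.eq x hx, add_sub_cancel_left, smul_smul]
  congr 1
  field_simp

/-- Frenet gives ∂ₓν = -κ|∂ₓγ|τ, while ν = -(ε/R)(γ-p) on the circle gives ∂ₓν = -(ε/R)∂ₓγ; compare
the coefficients of τ. -/
lemma IsImmersion.ae_curvature_of_isCircleParam (h : IsImmersion γ) (hR : 0 < R)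
    (hc : IsCircleParam γ R p θ ε) :
    ∀ᵐ x, x ∈ Ioo 0 (2 * Real.pi) → curvature γ x = ε / R := by
  filter_upwards [h.ae_hasDerivAt_tangent] with x hx hxI
  have hxI' : x ∈ I := Ioo_subset_Icc_self hxI
  have h1 := hasDerivAt_normal (hx hxI)
  have h2 : HasDerivAt (normal γ) (-(ε / R) • D γ x) x := by
    refine (((h.hasDerivAt hxI).sub_const p).const_smul (-(ε / R))).congr_of_eventuallyEq ?_
    filter_upwards [I_mem_nhds hxI] with y hy using h.normal_eq_smul_sub_of_isCircleParam hR hc hy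
  have h3 := h1.unique h2
  have h5 : -(ε / R) • D γ x = (-(ε / R) * ‖D γ x‖) • tangent γ x := by
    rw [mul_smul, h.speed_smul_tangent hxI']
  rw [h5] at h3
  have ht : tangent γ x ≠ 0 := norm_ne_zero_iff.1 (by rw [h.norm_tangent hxI']; norm_num)
  have hv : ‖D γ x‖ ≠ 0 := norm_ne_zero_iff.2 (h.2.1 x hxI')
  have h4 := smul_left_injective ℝ ht h3
  have : (curvature γ x - ε / R) * ‖D γ x‖ = 0 := by linear_combination -h4
  have := (mul_eq_zero.1 this).resolve_right hv
  linarith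

lemma IsImmersion.tracesCircleOnce (h : IsImmersion γ) (hR : 0 < R)
    (hc : IsCircleParam γ R p θ ε) : TracesCircleOnce γ R := by
  have hmono := h.strictMonoOn_arcLength
  have hL := hc.length_eq
  rw [length_eq_arcLength] at hL
  refine ⟨fun x hx y hy hxy => ?_, p, Subset.antisymm ?_ ?_⟩
  · have hxI : x ∈ I := Ico_subset_Icc_self hx
    have hyI : y ∈ I := Ico_subset_Icc_self hy
    rw [hc.eq x hxI, hc.eq y hyI] at hxy
    have h1 := cos_sub_eq_one_of_unitVec_eq (smul_right_injective Plane hR.ne' (add_left_cancel hxy))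
    have h2 : Real.cos (arcLength γ x / R - arcLength γ y / R) = 1 := by
      rcases hc.sign with he | he
      · rw [← h1, he]; congr 1; ring
      · rw [← h1, he, ← Real.cos_neg]; congr 1; ring
    have hb : ∀ z ∈ Ico 0 (2 * Real.pi), 0 ≤ arcLength γ z / R ∧ arcLength γ z / R < 2 * Real.pi := by
      intro z hz
      have hzI : z ∈ I := Ico_subset_Icc_self hz
      have a1 := hmono.monotoneOn zero_mem_I hzI hz.1
      rw [arcLength_zero] at a1
      have a2 := hmono hzI two_pi_mem_I hz.2
      rw [hL] at a2
      exact ⟨div_nonneg a1 hR.le, (div_lt_iff₀ hR).2 a2⟩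
    -- Both angles lie in the half-open interval [0, 2π), so their difference lies in (-2π, 2π),
    -- where the cosine is 1 only at 0.
    have h3 := (Real.cos_eq_one_iff_of_lt_of_lt (by linarith [(hb x hx).1, (hb y hy).2])
      (by linarith [(hb x hx).2, (hb y hy).1])).1 h2
    refine hmono.injOn hxI hyI ?_
    have := (div_left_inj' hR.ne').1 (sub_eq_zero.1 h3)
    exact this
  · rintro _ ⟨x, hx, rfl⟩
    rw [hc.eq x hx, mem_sphere_iff_norm, add_sub_cancel_left, norm_smul, norm_unitVec,
      Real.norm_of_nonneg hR.le, mul_one]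
  · intro y hy
    obtain ⟨φ, hφ⟩ := exists_eq_smul_unitVec (mem_sphere_iff_norm.1 hy)
    -- The angle from the starting point to y in the sense of travel, reduced to [0, 2π); R times it
    -- is the arc length at which the curve meets y.
    have ht := toIcoMod_mem_Ico Real.two_pi_pos 0 (ε * (φ - θ))
    have hn := self_sub_toIcoDiv_zsmul Real.two_pi_pos 0 (ε * (φ - θ))
    set t := toIcoMod Real.two_pi_pos 0 (ε * (φ - θ))
    set n := toIcoDiv Real.two_pi_pos 0 (ε * (φ - θ))
    rw [zero_add] at ht
    obtain ⟨x, hx, hxt⟩ := h.exists_arcLength_eq (t := t * R)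
      ⟨mul_nonneg ht.1 hR.le, by rw [hc.length_eq]; exact mul_le_mul_of_nonneg_right ht.2.le hR.le⟩
    refine ⟨x, hx, ?_⟩
    rw [hc.eq x hx, hxt, mul_div_cancel_right₀ _ hR.ne', ← hn]
    have h1 : θ + ε * (ε * (φ - θ) - n • (2 * Real.pi)) = φ - (ε * n) * (2 * Real.pi) := by
      rw [zsmul_eq_mul]
      linear_combination (φ - θ) * hc.sq
    have h2 : unitVec (φ - (ε * n) * (2 * Real.pi)) = unitVec φ := by
      rcases hc.sign with he | he
      · apply plane_ext <;> simp [he, Real.cos_sub_int_mul_two_pi, Real.sin_sub_int_mul_two_pi]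
      · apply plane_ext <;> simp [he, Real.cos_add_int_mul_two_pi, Real.sin_add_int_mul_two_pi]
    rw [h1, h2, ← hφ]
    abel

/-- On the circle γ-p is orthogonal to τ, hence γ-p = -εRν with a sign ε that is constant by
continuity. So γ-p rotates with angular velocity ε|∂ₓγ|/R. Closedness makes the length a positive
multiple of 2πR, and injectivity excludes a second turn. -/
lemma IsImmersion.exists_isCircleParam (h : IsImmersion γ) (hR : 0 < R)
    (hc : TracesCircleOnce γ R) : ∃ p θ ε, IsCircleParam γ R p θ ε := by
  obtain ⟨hinj, p, hp⟩ := hc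
  have hnorm : ∀ x ∈ I, ‖γ x - p‖ = R := fun x hx => by
    have : γ x ∈ Metric.sphere p R := hp ▸ mem_image_of_mem γ hx
    exact mem_sphere_iff_norm.1 this
  have hd := h.1.hasDerivWithinAt.1
  have horth : ∀ x ∈ I, inner ℝ (γ x - p) (tangent γ x) = 0 := by
    intro x hx
    have h1 := ((hd x hx).sub_const p).inner ℝ ((hd x hx).sub_const p)
    have h2 : HasDerivWithinAt (fun y => (inner ℝ (γ y - p) (γ y - p) : ℝ)) 0 I x := by
      refine (hasDerivWithinAt_const x I (R ^ 2)).congr (fun y hy => ?_) ?_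
      · rw [real_inner_self_eq_norm_sq, hnorm y hy]
      · rw [real_inner_self_eq_norm_sq, hnorm x hx]
    have h3 := (uniqueDiffOn_I x hx).eq_deriv _ h1 h2
    rw [real_inner_comm] at h3
    have h4 : inner ℝ (γ x - p) (D γ x) = 0 := by
      have := real_inner_comm (γ x - p) (D γ x)
      linarith
    rw [tangent, arcDeriv, inner_smul_right, h4, mul_zero]
  have hβc : ContinuousOn (fun x => (inner ℝ (γ x - p) (normal γ x) : ℝ)) I :=
    (h.1.1.sub continuousOn_const).inner h.continuousOn_normal
  obtain ⟨ε, hε, hβ⟩ : ∃ ε : ℝ, (ε = 1 ∨ ε = -1) ∧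
      ∀ x ∈ I, inner ℝ (γ x - p) (normal γ x) = -ε * R := by
    have hsq : EqOn ((fun x => (inner ℝ (γ x - p) (normal γ x) : ℝ)) ^ 2)
        ((fun _ => R) ^ 2) I := by
      intro x hx
      have := norm_sq_eq_inner_sq_add_inner_J_sq (h.norm_tangent hx) (γ x - p)
      rw [horth x hx, hnorm x hx] at this
      simp only [Pi.pow_apply]
      rw [this, normal]
      ring
    rcases isPreconnected_Icc.eq_or_eq_neg_of_sq_eq hβc continuousOn_const hsq
      (fun _ => hR.ne') with h1 | h1
    · exact ⟨-1, Or.inr rfl, fun x hx => (h1 hx).trans (by ring)⟩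
    · exact ⟨1, Or.inl rfl, fun x hx => (h1 hx).trans (by simp)⟩
  have hεsq : ε * ε = 1 := by rcases hε with h | h <;> rw [h] <;> norm_num
  have hz : ∀ x ∈ I, γ x - p = (-ε * R) • normal γ x := by
    intro x hx
    have := eq_inner_smul_add_inner_smul_J (h.norm_tangent hx) (γ x - p)
    rw [horth x hx, zero_smul, zero_add] at this
    rw [← hβ x hx]
    exact this
  have hDγ : ∀ x ∈ I, D γ x = (ε * (‖D γ x‖ / R)) • J (γ x - p) := by
    intro x hx
    rw [hz x hx, ← JCLM_apply, map_smul, JCLM_apply, normal, J_J, smul_neg, ← neg_smul, smul_smul]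
    conv_lhs => rw [← h.speed_smul_tangent hx]
    congr 1
    field_simp
    linear_combination (-‖D γ x‖) * hεsq
  obtain ⟨θ, hθ⟩ := exists_eq_smul_unitVec (hnorm 0 zero_mem_I)
  have hγ : ∀ x ∈ I, γ x = p + R • unitVec (θ + ε * (arcLength γ x / R)) := by
    intro x hx
    set φ : ℝ → ℝ := fun x => ε * (arcLength γ x / R) with hφ
    -- Rotating γ-p back by the angle φ should give a constant; its derivative vanishes because ∂ₓγ
    -- = φ' J(γ-p).
    have hy : ∀ y ∈ Icc 0 (2 * Real.pi), HasDerivWithinAt (fun y =>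
        Real.cos (φ y) • (γ y - p) - Real.sin (φ y) • J (γ y - p)) 0 (Icc 0 (2 * Real.pi)) y := by
      intro y hy
      have h1 : HasDerivWithinAt φ (ε * (‖D γ y‖ / R)) I y :=
        ((h.hasDerivWithinAt_arcLength hy).div_const R).const_mul ε
      have h2 := (hd y hy).sub_const p
      have h3 := JCLM.hasFDerivAt.comp_hasDerivWithinAt y h2
      have h4 := (h1.cos.smul h2).sub (h1.sin.smul h3)
      convert! h4 using 1
      simp only [Function.comp_apply, JCLM_apply]
      have h5 := hDγ y hy
      set c := ε * (‖D γ y‖ / R)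
      rw [h5, ← JCLM_apply (c • _), map_smul, JCLM_apply, J_J]
      module
    have h6 := constant_of_derivWithin_zero (fun y hy' => (hy y hy').differentiableWithinAt)
      (fun y hy' => (hy y (Ico_subset_Icc_self hy')).derivWithin
        (uniqueDiffOn_I y (Ico_subset_Icc_self hy'))) x hx
    have hφ0 : φ 0 = 0 := by simp [hφ, arcLength_zero]
    rw [hφ0, Real.cos_zero, Real.sin_zero, one_smul, zero_smul, sub_zero, hθ] at h6
    have h7 : γ x - p = R • unitVec (θ + φ x) := by
      rw [unitVec_add, smul_add, smul_comm R, smul_comm R, ← JCLM_apply, ← map_smul, ← h6, map_sub,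
        map_smul, map_smul, JCLM_apply, JCLM_apply, J_J]
      have h8 := Real.sin_sq_add_cos_sq (φ x)
      set C := Real.cos (φ x)
      set S := Real.sin (φ x)
      have : γ x - p = (S ^ 2 + C ^ 2) • (γ x - p) := by rw [h8, one_smul]
      rw [this]
      have hh : ∀ a b : Plane, (S ^ 2 + C ^ 2) • a = C • (C • a - S • b) + S • (C • b - S • -a) := by
        intro a b; module
      rw [← this]
      exact this.trans (hh _ _)
    rw [← h7]; abel
  refine ⟨p, θ, ε, hε, ?_, hγ⟩
  have hL := h.length_pos
  have hcos : Real.cos (length γ / R) = 1 := by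
    have h1 := h.2.2.1
    rw [hγ 0 zero_mem_I, hγ _ two_pi_mem_I, arcLength_zero, ← length_eq_arcLength] at h1
    have h2 := cos_sub_eq_one_of_unitVec_eq (smul_right_injective Plane hR.ne' (add_left_cancel h1))
    rw [← h2]
    rcases hε with he | he
    · rw [he, ← Real.cos_neg]; congr 1; ring
    · rw [he]; congr 1; ring
  obtain ⟨n, hn⟩ := (Real.cos_eq_one_iff _).1 hcos
  have hpos : 0 < length γ / R := div_pos hL hR
  have hn1 : (1 : ℝ) ≤ n := by
    have : (0 : ℝ) < n := by
      rw [← hn] at hpos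
      exact (mul_pos_iff_of_pos_right Real.two_pi_pos).1 hpos
    exact_mod_cast (by exact_mod_cast this : (0 : ℤ) < n)
  have hge : 2 * Real.pi * R ≤ length γ := by
    rw [← le_div_iff₀ hR, ← hn]
    nlinarith [Real.two_pi_pos]
  -- If the length exceeded 2πR, the point at arc length 2πR would be reached at a parameter in (0,
  -- 2π) and would coincide with the starting point.
  refine le_antisymm (not_lt.1 fun hlt => ?_) hge
  obtain ⟨x, hx, hxs⟩ := h.exists_arcLength_eq (t := 2 * Real.pi * R)
    ⟨by have := Real.two_pi_pos; positivity, hge⟩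
  have hx2 : x < 2 * Real.pi := by
    refine lt_of_le_of_ne hx.2 fun he => ?_
    rw [he, ← length_eq_arcLength] at hxs
    exact hlt.ne' hxs
  have hx0 : x ≠ 0 := by
    intro he
    rw [he, arcLength_zero] at hxs
    have := Real.two_pi_pos
    have : 0 < 2 * Real.pi * R := by positivity
    linarith
  refine hx0 (hinj ⟨hx.1, hx2⟩ ⟨le_rfl, Real.two_pi_pos⟩ ?_)
  rw [hγ x hx, hγ 0 zero_mem_I, hxs, arcLength_zero, mul_div_cancel_right₀ _ hR.ne']
  congr 2
  rcases hε with he | he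
  · apply plane_ext <;> simp [he]
  · apply plane_ext <;> simp [he, ← sub_eq_add_neg]

/-- Unit speed in arc length forces |-sin t · a + cos t · b| = R for all t in [0, 2π], which makes a
and b orthogonal of length R. Hence b = ±J a, and the ellipse is a circle. -/
lemma IsImmersion.exists_isCircleParam_of_trig (h : IsImmersion γ) (hR : 0 < R) {a b : Plane}
    (hL : length γ = 2 * Real.pi * R)
    (hγ : ∀ x ∈ I, γ x = p + Real.cos (arcLength γ x / R) • a + Real.sin (arcLength γ x / R) • b) :
    ∃ p θ ε, IsCircleParam γ R p θ ε := by
  have hnorm : ∀ x ∈ I,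
      ‖-Real.sin (arcLength γ x / R) • a + Real.cos (arcLength γ x / R) • b‖ = R := by
    intro x hx
    have h1 : HasDerivWithinAt (fun x => arcLength γ x / R) (‖D γ x‖ / R) I x :=
      (h.hasDerivWithinAt_arcLength hx).div_const R
    have h2 := (((h1.cos.smul_const a).const_add p).add (h1.sin.smul_const b)).congr hγ (hγ x hx)
    have h3 := h2.derivWithin (uniqueDiffOn_I x hx)
    change D γ x = _ at h3
    have h4 : D γ x = (‖D γ x‖ / R) •
        (-Real.sin (arcLength γ x / R) • a + Real.cos (arcLength γ x / R) • b) := by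
      conv_lhs => rw [h3]
      module
    have h5 := congrArg norm h4
    have hv : ‖D γ x‖ ≠ 0 := norm_ne_zero_iff.2 (h.2.1 x hx)
    rw [norm_smul, norm_div, norm_norm, Real.norm_of_nonneg hR.le] at h5
    field_simp at h5
    linarith
  have hnorm' : ∀ t ∈ Icc 0 (2 * Real.pi), ‖-Real.sin t • a + Real.cos t • b‖ ^ 2 = R ^ 2 := by
    intro t ht
    obtain ⟨x, hx, hxt⟩ := h.exists_arcLength_eq (t := t * R)
      ⟨mul_nonneg ht.1 hR.le, by rw [hL]; exact mul_le_mul_of_nonneg_right ht.2 hR.le⟩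
    have := hnorm x hx
    rw [hxt, mul_div_cancel_right₀ _ hR.ne'] at this
    rw [this]
  have hpi := Real.pi_pos
  -- The angles 0 and π/2 give |b| = R and |a| = R; π/4 then gives ⟨a, b⟩ = 0.
  have hb := hnorm' 0 ⟨le_rfl, by positivity⟩
  have ha := hnorm' (Real.pi / 2) ⟨by positivity, by linarith⟩
  have hab := hnorm' (Real.pi / 4) ⟨by positivity, by linarith⟩
  rw [Real.sin_zero, Real.cos_zero, norm_sq_plane] at hb
  rw [Real.sin_pi_div_two, Real.cos_pi_div_two, norm_sq_plane] at ha
  rw [Real.sin_pi_div_four, Real.cos_pi_div_four, norm_sq_plane] at hab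
  simp only [PiLp.add_apply, PiLp.smul_apply, smul_eq_mul] at ha hb hab
  have h2 : √2 ^ 2 = 2 := Real.sq_sqrt (by norm_num)
  have ha' : a 0 ^ 2 + a 1 ^ 2 = R ^ 2 := by linear_combination ha
  have hb' : b 0 ^ 2 + b 1 ^ 2 = R ^ 2 := by linear_combination hb
  have hab' : a 0 * b 0 + a 1 * b 1 = 0 := by
    linear_combination -hab + ha' / 2 + hb' / 2 +
      ((b 0 - a 0) ^ 2 + (b 1 - a 1) ^ 2) / 4 * h2
  obtain ⟨θ, hθ⟩ := exists_eq_smul_unitVec (z := a) (R := R) (by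
    rw [← sq_eq_sq₀ (norm_nonneg _) hR.le, norm_sq_plane, ha'])
  have hθ0 : a 0 = R * Real.cos θ := by rw [hθ]; simp
  have hθ1 : a 1 = R * Real.sin θ := by rw [hθ]; simp
  -- The normalized determinant of (a, b), that is, the coefficient in b = εJa.
  set ε := (b 1 * a 0 - b 0 * a 1) / R ^ 2 with hε
  have hb0 : b 0 = -ε * a 1 := by
    rw [hε]; field_simp; linear_combination -b 0 * ha' + a 0 * hab'
  have hb1 : b 1 = ε * a 0 := by
    rw [hε]; field_simp; linear_combination -b 1 * ha' + a 1 * hab'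
  have hε1 : ε ^ 2 = 1 := by
    have : ε ^ 2 * R ^ 2 = R ^ 2 := by
      rw [hb0, hb1] at hb'
      linear_combination hb' - ε ^ 2 * ha'
    exact (mul_eq_right₀ (by positivity)).1 this
  have hεs : ε = 1 ∨ ε = -1 := mul_self_eq_one_iff.1 (by rw [← sq]; exact hε1)
  refine ⟨p, θ, ε, hεs, hL, fun x hx => ?_⟩
  rw [hγ x hx, unitVec_add, add_assoc]
  congr 1
  set t := arcLength γ x / R
  have hcos : Real.cos (ε * t) = Real.cos t := by
    rcases hεs with he | he <;> simp [he]
  have hsin : Real.sin (ε * t) = ε * Real.sin t := by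
    rcases hεs with he | he <;> simp [he]
  rw [hcos, hsin]
  apply plane_ext
  · simp only [PiLp.add_apply, PiLp.smul_apply, smul_eq_mul, J_apply_zero, unitVec_apply_zero,
      unitVec_apply_one, hb0, hθ0, hθ1]
    ring
  · simp only [PiLp.add_apply, PiLp.smul_apply, smul_eq_mul, J_apply_one, unitVec_apply_zero,
      unitVec_apply_one, hb1, hθ0, hθ1]
    ring

end ArcLength

/-! ### The case of equality -/

section Equality

variable {γ η : ℝ → Plane} {R θ ε : ℝ} {p : Plane} {lam : ℝ}

lemma IsImmersion.ae_eq_zero_of_lineIntegral_sq (h : IsImmersion γ) {f : ℝ → ℝ}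
    (hf : MemLp f 2 (volume.restrict (Ioo 0 (2 * Real.pi))))
    (h0 : lineIntegral γ (fun x => f x ^ 2) = 0) :
    ∀ᵐ x, x ∈ Ioo 0 (2 * Real.pi) → f x = 0 := by
  have hi := h.intervalIntegrable_sq hf
  rw [intervalIntegrable_iff_integrableOn_Ioo_of_le Real.two_pi_pos.le] at hi
  rw [lineIntegral, intervalIntegral.integral_of_le Real.two_pi_pos.le,
    integral_Ioc_eq_integral_Ioo, setIntegral_eq_zero_iff_of_nonneg_ae
      (Filter.Eventually.of_forall fun x => by simp only [Pi.zero_apply]; positivity) hi] at h0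
  filter_upwards [(ae_restrict_iff' measurableSet_Ioo).1 h0] with x hx hxI
  have hv : ‖D γ x‖ ≠ 0 := norm_ne_zero_iff.2 (h.2.1 x (Ioo_subset_Icc_self hxI))
  simpa [hv] using hx hxI

lemma lineIntegral_congr_ae {f g : ℝ → ℝ}
    (h : ∀ᵐ x, x ∈ Ioo 0 (2 * Real.pi) → f x = g x) :
    lineIntegral γ f = lineIntegral γ g := by
  refine intervalIntegral.integral_congr_ae ?_
  have hne : ∀ᵐ t : ℝ, t ≠ 2 * Real.pi := by simp [ae_iff]
  filter_upwards [h, hne] with x hx hne hxI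
  rw [uIoc_of_le Real.two_pi_pos.le] at hxI
  rw [hx ⟨hxI.1, lt_of_le_of_ne hxI.2 hne⟩]

/-- An absolutely continuous plane field with vanishing derivative is constant. -/
lemma exists_eq_const_of_ae_hasDerivAt_zero {u : ℝ → Plane}
    (hAC : ∀ i : Fin 2, AbsolutelyContinuousOnInterval (fun x => u x i) 0 (2 * Real.pi))
    (h : ∀ᵐ x, x ∈ Ioo 0 (2 * Real.pi) → HasDerivAt u 0 x) : ∃ c : Plane, ∀ x ∈ I, u x = c := by
  have key : ∀ i : Fin 2, ∃ c : ℝ, ∀ x ∈ uIcc 0 (2 * Real.pi), u x i = c := by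
    intro i
    refine (hAC i).const_of_ae_hasDerivAt_zero ?_
    have hne0 : ∀ᵐ t : ℝ, t ≠ 0 := by simp [ae_iff]
    have hne : ∀ᵐ t : ℝ, t ≠ 2 * Real.pi := by simp [ae_iff]
    filter_upwards [h, hne0, hne] with x hx h0 h1 hxI
    rw [uIcc_of_le Real.two_pi_pos.le] at hxI
    have h2 := (EuclideanSpace.proj i : Plane →L[ℝ] ℝ).hasFDerivAt.comp_hasDerivAt x
      (hx ⟨lt_of_le_of_ne hxI.1 h0.symm, lt_of_le_of_ne hxI.2 h1⟩)
    rw [map_zero] at h2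
    exact h2
  obtain ⟨c0, h0⟩ := key 0
  obtain ⟨c1, h1⟩ := key 1
  rw [uIcc_of_le Real.two_pi_pos.le] at h0 h1
  exact ⟨!₂[c0, c1], fun x hx => plane_ext (h0 x hx) (h1 x hx)⟩

lemma IsImmersion.absolutelyContinuous_normal (h : IsImmersion γ) (i : Fin 2) :
    AbsolutelyContinuousOnInterval (fun x => normal γ x i) 0 (2 * Real.pi) := by
  fin_cases i
  · exact (h.absolutelyContinuous_tangent 1).fun_neg
  · exact h.absolutelyContinuous_tangent 0

/-- A pair of least energy consists of a circle and a multiple of its normal. -/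
lemma IsImmersion.circle_of_energy_eq (h : IsImmersion γ) (hη : IsH1 η) (δ : ℝ) (hlam : 0 < lam)
    (hE : energy lam δ γ η = lowerBound lam δ) :
    (∃ p θ ε, IsCircleParam γ (optRadius lam δ) p θ ε) ∧
      ∃ c : Plane, ∀ x ∈ I, η x = (δ / (lam + δ ^ 2)) • normal γ x + c := by
  obtain ⟨hP, hQ, hL, p, a, b, hγ⟩ := (h.lowerBound_le_energy hη δ hlam).2 hE
  refine ⟨h.exists_isCircleParam_of_trig (optRadius_pos δ hlam) hL hγ, ?_⟩
  have hd : MemLp (divergence γ η) 2 (volume.restrict (Ioo 0 (2 * Real.pi))) :=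
    h.memLp_arcDeriv hη h.continuousOn_tangent
  have he : MemLp (normalPart γ η) 2 (volume.restrict (Ioo 0 (2 * Real.pi))) :=
    h.memLp_arcDeriv hη h.continuousOn_normal
  have h1 := h.ae_eq_zero_of_lineIntegral_sq
    (hd.add (h.memLp_curvature.const_mul (δ / (lam + δ ^ 2)))) hP
  have h2 := h.ae_eq_zero_of_lineIntegral_sq he hQ
  obtain ⟨g, hg⟩ := hη.exists_isPrimitive
  set k := δ / (lam + δ ^ 2)
  -- The vanishing squares say ∂ₛη = -kκτ almost everywhere, and the Frenet equation for ν says that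
  -- k∂ₛν is the same.
  obtain ⟨c, hc⟩ := exists_eq_const_of_ae_hasDerivAt_zero (u := fun x => η x - k • normal γ x)
    (fun i => (hg.absolutelyContinuous i).fun_sub ((h.absolutelyContinuous_normal i).const_mul k)) (by
    filter_upwards [h1, h2, hg.ae_hasDerivAt, h.ae_hasDerivAt_tangent] with x h1 h2 h3 h4 hx
    have hxI : x ∈ I := Ioo_subset_Icc_self hx
    have h5 := (h3 hx).sub ((hasDerivAt_normal (h4 hx)).const_smul k)
    convert! h5 using 1
    have hDη : D η x = g x := D_eq_of_hasDerivAt hxI (h3 hx)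
    have hv : ‖D γ x‖ ≠ 0 := norm_ne_zero_iff.2 (h.2.1 x hxI)
    have h6 := eq_inner_smul_add_inner_smul_J (h.norm_tangent hxI) (arcDeriv γ η x)
    have h7 : inner ℝ (arcDeriv γ η x) (tangent γ x) = -(k * curvature γ x) :=
      eq_neg_of_add_eq_zero_left (h1 hx)
    have h8 : inner ℝ (arcDeriv γ η x) (J (tangent γ x)) = 0 := h2 hx
    rw [h7, h8, zero_smul, add_zero, arcDeriv, hDη, inv_smul_eq_iff₀ hv] at h6
    rw [h6]
    module)
  exact ⟨c, fun x hx => by rw [← hc x hx]; abel⟩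

/-- Both squares in ∂ₛη vanish and κ² = 1/R², so the energy reduces to R²·L/R² + L = 2L = 4πR. -/
lemma IsImmersion.energy_eq_of_isCircleParam (h : IsImmersion γ) (hη : IsH1 η) (δ : ℝ)
    (hlam : 0 < lam) (hc : IsCircleParam γ (optRadius lam δ) p θ ε) {c : Plane}
    (hηc : ∀ x ∈ I, η x = (δ / (lam + δ ^ 2)) • normal γ x + c) :
    energy lam δ γ η = lowerBound lam δ := by
  have hR := optRadius_pos δ hlam
  have hκ := h.ae_curvature_of_isCircleParam hR hc
  set k := δ / (lam + δ ^ 2) with hk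
  have hD : ∀ᵐ x, x ∈ Ioo 0 (2 * Real.pi) →
      arcDeriv γ η x = -(k * curvature γ x) • tangent γ x := by
    filter_upwards [h.ae_hasDerivAt_tangent] with x h4 hx
    have hxI : x ∈ I := Ioo_subset_Icc_self hx
    have hv : ‖D γ x‖ ≠ 0 := norm_ne_zero_iff.2 (h.2.1 x hxI)
    have h5 : HasDerivAt η (k • (-(curvature γ x * ‖D γ x‖) • tangent γ x)) x := by
      refine (((hasDerivAt_normal (h4 hx)).const_smul k).add_const c).congr_of_eventuallyEq ?_
      filter_upwards [I_mem_nhds hx] with y hy using hηc y hy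
    rw [arcDeriv, D_eq_of_hasDerivAt hxI h5, smul_smul, smul_smul]
    congr 1
    field_simp
  have hP : lineIntegral γ (fun x => (divergence γ η x + k * curvature γ x) ^ 2) = 0 := by
    rw [lineIntegral_congr_ae (g := fun _ => 0)]
    · simp [lineIntegral]
    filter_upwards [hD] with x hx hxI
    rw [divergence, hx hxI, inner_smul_left, real_inner_self_eq_norm_sq,
      h.norm_tangent (Ioo_subset_Icc_self hxI)]
    simp
  have hQ : lineIntegral γ (fun x => normalPart γ η x ^ 2) = 0 := by
    rw [lineIntegral_congr_ae (g := fun _ => 0)]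
    · simp [lineIntegral]
    filter_upwards [hD] with x hx hxI
    rw [normalPart, hx hxI, inner_smul_left, normal, inner_J_self]
    simp
  have hK : lineIntegral γ (fun x => curvature γ x ^ 2) =
      (1 / optRadius lam δ ^ 2) * length γ := by
    rw [lineIntegral_congr_ae (g := fun _ => 1 / optRadius lam δ ^ 2)]
    · simp [lineIntegral, length]
    filter_upwards [hκ] with x hx hxI
    rw [hx hxI, div_pow, sq ε, hc.sq]
  rw [h.energy_eq hη δ hlam, ← hk, hP, hQ, hK, ← optRadius_sq δ hlam, lowerBound_eq δ hlam,
    hc.length_eq]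
  field_simp
  ring

/-! ### Constant speed -/

lemma arcLength_of_constSpeed (hs : ConstSpeed γ) (hL : length γ = 2 * Real.pi * R)
    {x : ℝ} (hx : x ∈ I) : arcLength γ x = R * x := by
  have h1 : arcLength γ x = ∫ _ in (0 : ℝ)..x, R := by
    refine intervalIntegral.integral_congr fun t ht => ?_
    rw [uIcc_of_le hx.1] at ht
    have hpi := Real.pi_ne_zero
    show ‖D γ t‖ = R
    rw [hs t ⟨ht.1, ht.2.trans hx.2⟩, hL]
    field_simp
  rw [h1]
  simp [mul_comm]

lemma IsCircleParam.arg_of_constSpeed (hR : 0 < R) (hc : IsCircleParam γ R p θ ε)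
    (hs : ConstSpeed γ) {x : ℝ} (hx : x ∈ I) :
    θ + ε * (arcLength γ x / R) = θ + ε * x := by
  rw [arcLength_of_constSpeed hs hc.length_eq hx]
  field_simp

lemma integral_unitVec (hε : ε * ε = 1) :
    ∫ x in (0 : ℝ)..(2 * Real.pi), unitVec (θ + ε * x) = 0 := by
  have hd : ∀ x : ℝ, HasDerivAt (fun x => -(ε • J (unitVec (θ + ε * x)))) (unitVec (θ + ε * x)) x := by
    intro x
    have h1 : HasDerivAt (fun x : ℝ => θ + ε * x) ε x := by
      simpa using ((hasDerivAt_id x).const_mul ε).const_add θ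
    have h2 := ((JCLM.hasFDerivAt.comp_hasDerivAt x
      ((hasDerivAt_unitVec _).scomp x h1)).const_smul ε).neg
    convert! h2 using 1
    rw [map_smul, JCLM_apply, J_J, smul_smul, hε, one_smul, neg_neg]
  have hcont : Continuous fun x => unitVec (θ + ε * x) :=
    continuous_unitVec.comp (by fun_prop)
  rw [intervalIntegral.integral_eq_sub_of_hasDerivAt (fun x _ => hd x)
    (hcont.intervalIntegrable _ _), mul_zero, add_zero]
  have hper : unitVec (θ + ε * (2 * Real.pi)) = unitVec θ := by
    rcases mul_self_eq_one_iff.1 hε with he | he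
    · apply plane_ext <;> simp [he]
    · apply plane_ext <;> simp [he, ← sub_eq_add_neg]
  rw [hper, sub_self]

lemma integral_congr_I {u w : ℝ → Plane} (h : ∀ x ∈ I, u x = w x) :
    ∫ x in (0 : ℝ)..(2 * Real.pi), u x = ∫ x in (0 : ℝ)..(2 * Real.pi), w x := by
  refine intervalIntegral.integral_congr fun x hx => ?_
  rw [uIcc_of_le Real.two_pi_pos.le] at hx
  exact h x hx

lemma continuous_unitVec_affine (c : ℝ) : Continuous fun x => c • unitVec (θ + ε * x) :=
  (continuous_unitVec.comp (by fun_prop)).const_smul c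

/-- The trigonometric part integrates to zero over a full period. This removes both the centre of
the circle and the additive constant in η. -/
lemma eq_zero_of_meanZero {u : ℝ → Plane} {c : Plane} {a : ℝ} (hε : ε * ε = 1)
    (hu : ∀ x ∈ I, u x = a • unitVec (θ + ε * x) + c) (h0 : MeanZero u) : c = 0 := by
  rw [MeanZero, integral_congr_I hu, intervalIntegral.integral_add
    ((continuous_unitVec_affine a).intervalIntegrable _ _)
    (continuous_const.intervalIntegrable _ _), intervalIntegral.integral_smul,
    integral_unitVec hε, smul_zero, zero_add, intervalIntegral.integral_const, sub_zero] at h0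
  exact (smul_eq_zero.1 h0).resolve_left Real.two_pi_pos.ne'

lemma meanZero_of_eq {u : ℝ → Plane} {a : ℝ} (hε : ε * ε = 1)
    (hu : ∀ x ∈ I, u x = a • unitVec (θ + ε * x)) : MeanZero u := by
  rw [MeanZero, integral_congr_I hu, intervalIntegral.integral_smul, integral_unitVec hε, smul_zero]

lemma IsImmersion.const_eq_zero_of_meanZero (h : IsImmersion γ) (hR : 0 < R)
    (hc : IsCircleParam γ R p θ ε) (hs : ConstSpeed γ) (h0 : MeanZero η) {k : ℝ} {c : Plane}
    (hη : ∀ x ∈ I, η x = k • normal γ x + c) : c = 0 := by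
  refine eq_zero_of_meanZero (θ := θ) (a := k * -ε) hc.sq (fun x hx => ?_) h0
  rw [hη x hx, h.normal_of_isCircleParam hR hc hx, hc.arg_of_constSpeed hR hs hx, smul_smul]

/-- About the origin γ is a multiple of ν, so the integrand is a constant multiple of the speed and
the area reduces to the length. The sign of the area is thus ε. -/
lemma IsImmersion.signedArea_of_isCircleParam (h : IsImmersion γ) (hR : 0 < R)
    (hc : IsCircleParam γ R 0 θ ε) : signedArea γ = ε * (Real.pi * R ^ 2) := by
  have h1 : ∫ x in (0 : ℝ)..(2 * Real.pi), inner ℝ (γ x) (J (D γ x)) =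
      ∫ x in (0 : ℝ)..(2 * Real.pi), -(ε * R) * ‖D γ x‖ := by
    refine intervalIntegral.integral_congr fun x hx => ?_
    rw [uIcc_of_le Real.two_pi_pos.le] at hx
    have hD := h.D_of_isCircleParam hR hc hx
    set v := ‖D γ x‖ with hv
    show inner ℝ (γ x) (J (D γ x)) = -(ε * R) * v
    rw [hD, hc.eq x hx, ← JCLM_apply, map_smul, JCLM_apply, J_J, zero_add,
      inner_smul_left, inner_smul_right, inner_neg_right, real_inner_self_eq_norm_sq, norm_unitVec]
    simp
    ring
  have h2 : ∫ x in (0 : ℝ)..(2 * Real.pi), ‖D γ x‖ = 2 * Real.pi * R := by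
    rw [← hc.length_eq, length_eq_arcLength, arcLength]
  rw [signedArea, h1, intervalIntegral.integral_const_mul, h2]
  ring

end Equality

/-! ### The optimal circles -/

/-- The circle of radius `R` about the origin with constant speed and orientation `ε`. -/
def circle (R ε : ℝ) (x : ℝ) : Plane := R • unitVec (ε * x)

section Circle

variable {R ε : ℝ}

lemma hasDerivAt_circle (x : ℝ) : HasDerivAt (circle R ε) ((ε * R) • J (unitVec (ε * x))) x := by
  have h1 : HasDerivAt (fun x : ℝ => ε * x) ε x := by
    simpa using (hasDerivAt_id x).const_mul ε
  have h2 := ((hasDerivAt_unitVec _).scomp x h1).const_smul R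
  rw [smul_smul, mul_comm] at h2
  exact h2

lemma hasDerivAt_deriv_circle (x : ℝ) :
    HasDerivAt (fun x => (ε * R) • J (unitVec (ε * x))) (-(ε * R * ε) • unitVec (ε * x)) x := by
  have h1 : HasDerivAt (fun x : ℝ => ε * x) ε x := by
    simpa using (hasDerivAt_id x).const_mul ε
  have h2 := (JCLM.hasFDerivAt.comp_hasDerivAt x
    ((hasDerivAt_unitVec _).scomp x h1)).const_smul (ε * R)
  convert! h2 using 1
  rw [map_smul, JCLM_apply, J_J, smul_neg, smul_neg, smul_smul, neg_smul]

lemma continuous_circle : Continuous (circle R ε) :=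
  (continuous_unitVec.comp (by fun_prop)).const_smul R

lemma continuous_deriv_circle : Continuous fun x => (ε * R) • J (unitVec (ε * x)) :=
  continuous_iff_continuousAt.2 fun x => (hasDerivAt_deriv_circle x).continuousAt

lemma unitVec_mul_two_pi (hε : ε * ε = 1) : unitVec (ε * (2 * Real.pi)) = unitVec (ε * 0) := by
  rcases mul_self_eq_one_iff.1 hε with he | he <;> apply plane_ext <;> simp [he]

lemma D_circle {x : ℝ} (hx : x ∈ I) : D (circle R ε) x = (ε * R) • J (unitVec (ε * x)) :=
  D_eq_of_hasDerivAt hx (hasDerivAt_circle x)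

lemma norm_D_circle (hR : 0 < R) (hε : ε * ε = 1) {x : ℝ} (hx : x ∈ I) :
    ‖D (circle R ε) x‖ = R := by
  rw [D_circle hx, norm_smul, norm_J_unitVec, mul_one, norm_mul, Real.norm_of_nonneg hR.le]
  rcases mul_self_eq_one_iff.1 hε with he | he <;> simp [he]

lemma isImmersion_circle (hR : 0 < R) (hε : ε * ε = 1) : IsImmersion (circle R ε) := by
  refine ⟨⟨continuous_circle.continuousOn, _, fun x => -(ε * R * ε) • unitVec (ε * x),
    inL2_of_continuous continuous_deriv_circle, inL2_of_continuous
      ((continuous_unitVec.comp (by fun_prop)).const_smul (-(ε * R * ε))),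
    hasWeakDeriv_of_hasDerivAt hasDerivAt_circle continuous_deriv_circle,
    hasWeakDeriv_of_hasDerivAt hasDerivAt_deriv_circle
      ((continuous_unitVec.comp (by fun_prop)).const_smul (-(ε * R * ε)))⟩, fun x hx => ?_, ?_, ?_⟩
  · exact norm_ne_zero_iff.1 (by rw [norm_D_circle hR hε hx]; exact hR.ne')
  · rw [circle, circle, unitVec_mul_two_pi hε]
  · rw [D_circle zero_mem_I, D_circle two_pi_mem_I, unitVec_mul_two_pi hε]

lemma length_circle (hR : 0 < R) (hε : ε * ε = 1) : length (circle R ε) = 2 * Real.pi * R := by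
  rw [length_eq_arcLength, arcLength, intervalIntegral.integral_congr (g := fun _ => R)]
  · simp
  · intro x hx
    rw [uIcc_of_le Real.two_pi_pos.le] at hx
    exact norm_D_circle hR hε hx

lemma constSpeed_circle (hR : 0 < R) (hε : ε * ε = 1) : ConstSpeed (circle R ε) := by
  intro x hx
  rw [norm_D_circle hR hε hx, length_circle hR hε]
  have := Real.pi_ne_zero
  field_simp

lemma isCircleParam_circle (hR : 0 < R) (hε : ε * ε = 1) :
    IsCircleParam (circle R ε) R 0 0 ε := by
  refine ⟨mul_self_eq_one_iff.1 hε, length_circle hR hε, fun x hx => ?_⟩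
  rw [arcLength_of_constSpeed (constSpeed_circle hR hε) (length_circle hR hε) hx,
    mul_div_cancel_left₀ _ hR.ne', zero_add, zero_add, circle]

lemma isH1Per_circle (hε : ε * ε = 1) : IsH1Per (circle R ε) :=
  ⟨⟨continuous_circle.continuousOn, _, inL2_of_continuous continuous_deriv_circle,
    hasWeakDeriv_of_hasDerivAt hasDerivAt_circle continuous_deriv_circle⟩, by
    rw [circle, circle, unitVec_mul_two_pi hε]⟩

lemma meanZero_circle (hε : ε * ε = 1) : MeanZero (circle R ε) :=
  meanZero_of_eq (θ := 0) hε fun x _ => by rw [zero_add, circle]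

lemma energy_circle {lam : ℝ} (δ : ℝ) (hlam : 0 < lam) (hε : ε * ε = 1) :
    energy lam δ (circle (optRadius lam δ) ε) (circle (-(δ / (lam + δ ^ 2) * ε)) ε) =
      lowerBound lam δ := by
  have hR := optRadius_pos δ hlam
  have hi := isImmersion_circle hR hε
  have hc := isCircleParam_circle hR hε
  refine hi.energy_eq_of_isCircleParam (isH1Per_circle hε).1 δ hlam hc (c := 0) fun x hx => ?_
  rw [hi.normal_of_isCircleParam hR hc hx,
    hc.arg_of_constSpeed hR (constSpeed_circle hR hε) hx, zero_add, add_zero, smul_smul, circle]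
  congr 1
  ring

end Circle

/-! ### Normalized minimizers -/

section Minimizer

variable {lam : ℝ} {γ η : ℝ → Plane}

lemma isNormalizedMinimizer_circle (δ : ℝ) (hlam : 0 < lam) {ε : ℝ} (hε : ε * ε = 1) :
    IsNormalizedMinimizer lam δ (circle (optRadius lam δ) ε)
      (circle (-(δ / (lam + δ ^ 2) * ε)) ε) := by
  have hR := optRadius_pos δ hlam
  refine ⟨⟨isImmersion_circle hR hε, isH1Per_circle hε, meanZero_circle hε, meanZero_circle hε⟩,
    fun q hq => ?_, constSpeed_circle hR hε⟩
  show energy lam δ _ _ ≤ energy lam δ q.1 q.2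
  rw [energy_circle δ hlam hε]
  exact (hq.1.lowerBound_le_energy hq.2.1.1 δ hlam).1

/-- The explicit circle is admissible and attains the lower bound, so the constrained minimum equals
it and the equality case applies. The normalizations leave only the starting angle θ and the
orientation ε free. -/
lemma IsNormalizedMinimizer.exists_unitVec {δ : ℝ} (hlam : 0 < lam)
    (h : IsNormalizedMinimizer lam δ γ η) :
    ∃ θ ε : ℝ, (ε = 1 ∨ ε = -1) ∧ signedArea γ = ε * (Real.pi * optRadius lam δ ^ 2) ∧
      ∀ x ∈ I, γ x = optRadius lam δ • unitVec (θ + ε * x) ∧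
        η x = (-(δ / (lam + δ ^ 2) * ε)) • unitVec (θ + ε * x) := by
  have hR := optRadius_pos δ hlam
  obtain ⟨⟨hγ, hη, hγ0, hη0⟩, hmin, hs⟩ := h
  dsimp only at hγ hη hγ0 hη0
  have hE : energy lam δ γ η = lowerBound lam δ := by
    refine le_antisymm ?_ (hγ.lowerBound_le_energy hη.1 δ hlam).1
    rw [← energy_circle δ hlam (ε := 1) (one_mul 1)]
    exact isMinOn_iff.1 hmin
      (circle (optRadius lam δ) 1, circle (-(δ / (lam + δ ^ 2) * 1)) 1)
      (isNormalizedMinimizer_circle δ hlam (one_mul 1)).1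
  obtain ⟨⟨p, θ, ε, hc⟩, c, hηc⟩ := hγ.circle_of_energy_eq hη.1 δ hlam hE
  have hc0 := hγ.const_eq_zero_of_meanZero hR hc hs hη0 hηc
  have hp : p = 0 := by
    refine eq_zero_of_meanZero (θ := θ) (a := optRadius lam δ) hc.sq (fun x hx => ?_) hγ0
    rw [hc.eq x hx, hc.arg_of_constSpeed hR hs hx, add_comm]
  subst hp
  refine ⟨θ, ε, hc.sign, hγ.signedArea_of_isCircleParam hR hc, fun x hx => ⟨?_, ?_⟩⟩
  · rw [hc.eq x hx, hc.arg_of_constSpeed hR hs hx, zero_add]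
  · rw [hηc x hx, hc0, hγ.normal_of_isCircleParam hR hc hx, hc.arg_of_constSpeed hR hs hx,
      smul_smul, add_zero]
    congr 1
    ring

end Minimizer

end Surfactant

end

/-! ### The main theorem -/

open Surfactant in
theorem corollary4p6 (lam δ : ℝ) (hlam : 0 < lam) :
    -- the lower bound
    (∀ γ η : ℝ → Plane, IsImmersion γ → IsH1Per η → lowerBound lam δ ≤ energy lam δ γ η) ∧
    -- it is attained by a normalized pair
    (∃ γ η : ℝ → Plane, IsImmersion γ ∧ IsH1Per η ∧ ConstSpeed γ ∧ MeanZero γ ∧ MeanZero η ∧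
      energy lam δ γ η = lowerBound lam δ) ∧
    -- the equality case, in any parametrization and without normalization
    (∀ γ η : ℝ → Plane, IsImmersion γ → IsH1Per η →
      (energy lam δ γ η = lowerBound lam δ ↔
        TracesCircleOnce γ (√lam / √(2 * (lam + δ ^ 2))) ∧
          ∃ c : Plane, ∀ x ∈ I, η x = (δ / (lam + δ ^ 2)) • normal γ x + c)) ∧
    -- the equality case for constant speed and mean-zero `η`
    (∀ γ η : ℝ → Plane, IsImmersion γ → IsH1Per η → ConstSpeed γ → MeanZero η →
      (energy lam δ γ η = lowerBound lam δ ↔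
        TracesCircleOnce γ (√lam / √(2 * (lam + δ ^ 2))) ∧
          ∀ x ∈ I, η x = (δ / (lam + δ ^ 2)) • normal γ x)) ∧
    -- the normalized minimization problem: existence for each orientation
    (∃ γ η : ℝ → Plane, IsNormalizedMinimizer lam δ γ η ∧ 0 < signedArea γ) ∧
    (∃ γ η : ℝ → Plane, IsNormalizedMinimizer lam δ γ η ∧ signedArea γ < 0) ∧
    (∀ γ η : ℝ → Plane, IsNormalizedMinimizer lam δ γ η → signedArea γ ≠ 0) ∧
    -- uniqueness up to rotation among minimizers of the same orientation
    (∀ γ₁ η₁ γ₂ η₂ : ℝ → Plane,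
      IsNormalizedMinimizer lam δ γ₁ η₁ → IsNormalizedMinimizer lam δ γ₂ η₂ →
      0 < signedArea γ₁ * signedArea γ₂ →
      ∃ θ : ℝ, ∀ x ∈ I, γ₂ x = rot θ (γ₁ x) ∧ η₂ x = rot θ (η₁ x)) ∧
    -- minimizers of opposite orientation differ by a rotation and a reversal
    (∀ γ₁ η₁ γ₂ η₂ : ℝ → Plane,
      IsNormalizedMinimizer lam δ γ₁ η₁ → IsNormalizedMinimizer lam δ γ₂ η₂ →
      signedArea γ₁ * signedArea γ₂ < 0 →
      ∃ θ : ℝ, ∀ x ∈ I,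
        γ₂ x = rot θ (reverse γ₁ x) ∧ η₂ x = - rot θ (reverse η₁ x)) := by
  have hR := optRadius_pos δ hlam
  have one : (1 : ℝ) * 1 = 1 := one_mul 1
  have neg_one : (-1 : ℝ) * -1 = 1 := by norm_num
  have hrad : √lam / √(2 * (lam + δ ^ 2)) = optRadius lam δ := rfl
  -- Reversing the parameter replaces ε by -ε up to a full turn, so a reversed minimizer becomes
  -- comparable with one of the opposite orientation.
  have htwo : ∀ θ ε : ℝ, (ε = 1 ∨ ε = -1) → ∀ x : ℝ,
      unitVec (θ + ε * (2 * Real.pi - x)) = unitVec (θ - ε * x) := by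
    rintro θ ε (rfl | rfl) x
    · rw [show θ + 1 * (2 * Real.pi - x) = θ - 1 * x + 2 * Real.pi by ring]
      apply plane_ext <;> simp
    · rw [show θ + -1 * (2 * Real.pi - x) = θ - -1 * x - 2 * Real.pi by ring]
      apply plane_ext <;> simp
  rw [hrad]
  refine ⟨fun γ η hγ hη => (hγ.lowerBound_le_energy hη.1 δ hlam).1, ?_, ?_, ?_, ?_, ?_, ?_, ?_, ?_⟩
  · exact ⟨_, _, isImmersion_circle hR one, isH1Per_circle one, constSpeed_circle hR one,
      meanZero_circle one, meanZero_circle one, energy_circle δ hlam one⟩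
  · refine fun γ η hγ hη => ⟨fun h => ?_, fun ⟨hT, c, hc⟩ => ?_⟩
    · obtain ⟨⟨p, θ, ε, hp⟩, hc⟩ := hγ.circle_of_energy_eq hη.1 δ hlam h
      exact ⟨hγ.tracesCircleOnce hR hp, hc⟩
    · obtain ⟨p, θ, ε, hp⟩ := hγ.exists_isCircleParam hR hT
      exact hγ.energy_eq_of_isCircleParam hη.1 δ hlam hp hc
  · refine fun γ η hγ hη hs h0 => ⟨fun h => ?_, fun ⟨hT, hc⟩ => ?_⟩
    · obtain ⟨⟨p, θ, ε, hp⟩, c, hc⟩ := hγ.circle_of_energy_eq hη.1 δ hlam h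
      rw [hγ.const_eq_zero_of_meanZero hR hp hs h0 hc] at hc
      exact ⟨hγ.tracesCircleOnce hR hp, fun x hx => by rw [hc x hx, add_zero]⟩
    · obtain ⟨p, θ, ε, hp⟩ := hγ.exists_isCircleParam hR hT
      exact hγ.energy_eq_of_isCircleParam hη.1 δ hlam hp (c := 0)
        fun x hx => by rw [hc x hx, add_zero]
  · refine ⟨_, _, isNormalizedMinimizer_circle δ hlam one, ?_⟩
    rw [(isImmersion_circle hR one).signedArea_of_isCircleParam hR (isCircleParam_circle hR one)]
    positivity
  · refine ⟨_, _, isNormalizedMinimizer_circle δ hlam neg_one, ?_⟩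
    rw [(isImmersion_circle hR neg_one).signedArea_of_isCircleParam hR
      (isCircleParam_circle hR neg_one), neg_one_mul, neg_lt_zero]
    positivity
  · intro γ η h
    obtain ⟨θ, ε, hε, hA, -⟩ := h.exists_unitVec hlam
    have : Real.pi * optRadius lam δ ^ 2 ≠ 0 := by positivity
    rw [hA]
    rcases hε with rfl | rfl <;> simpa using this
  · intro γ₁ η₁ γ₂ η₂ h₁ h₂ hA
    obtain ⟨θ₁, ε₁, hε₁, hA₁, hf₁⟩ := h₁.exists_unitVec hlam
    obtain ⟨θ₂, ε₂, hε₂, hA₂, hf₂⟩ := h₂.exists_unitVec hlam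
    have hpos : 0 < Real.pi * optRadius lam δ ^ 2 := by positivity
    have hε : ε₂ = ε₁ := by
      rw [hA₁, hA₂] at hA
      rcases hε₁ with rfl | rfl <;> rcases hε₂ with rfl | rfl <;> first | rfl | nlinarith
    subst hε
    refine ⟨θ₂ - θ₁, fun x hx => ?_⟩
    rw [(hf₁ x hx).1, (hf₁ x hx).2, (hf₂ x hx).1, (hf₂ x hx).2, rot_smul, rot_smul, rot_unitVec,
      show θ₂ - θ₁ + (θ₁ + ε₂ * x) = θ₂ + ε₂ * x by ring]
    exact ⟨rfl, rfl⟩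
  · intro γ₁ η₁ γ₂ η₂ h₁ h₂ hA
    obtain ⟨θ₁, ε₁, hε₁, hA₁, hf₁⟩ := h₁.exists_unitVec hlam
    obtain ⟨θ₂, ε₂, hε₂, hA₂, hf₂⟩ := h₂.exists_unitVec hlam
    have hpos : 0 < Real.pi * optRadius lam δ ^ 2 := by positivity
    have hε : ε₂ = -ε₁ := by
      rw [hA₁, hA₂] at hA
      rcases hε₁ with rfl | rfl <;> rcases hε₂ with rfl | rfl <;> first | (norm_num; done) | nlinarith
    subst hε
    refine ⟨θ₂ - θ₁, fun x hx => ?_⟩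
    have hx' : 2 * Real.pi - x ∈ I := ⟨by linarith [hx.2], by linarith [hx.1]⟩
    rw [reverse, reverse, (hf₁ _ hx').1, (hf₁ _ hx').2, (hf₂ x hx).1, (hf₂ x hx).2, rot_smul,
      rot_smul, htwo _ _ hε₁, rot_unitVec,
      show θ₂ - θ₁ + (θ₁ - ε₁ * x) = θ₂ + -ε₁ * x by ring]
    -- The amplitude -kε of η changes sign with the orientation while that of γ does not; hence the
    -- minus sign for the field only.
    refine ⟨rfl, ?_⟩
    rw [← neg_smul]
    congr 1
    ring
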